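/- **Asymptotic secrecy outage probability (SOP) when the RF link is wiretapped.** *Setting.* For $j\in\{R,\mathcal E\}$ (the relay and the eavesdropper) let $L_j\ge 1$ be an integer and $\alpha_j,\kappa_j,\mu_j,D_j,\varrho_j>0$. Let $(C_1,C_2,C_3)=\frac1{72}(735,-1190,455)$ and $(\beta_1,\beta_2,\beta_3)=(2,4,6)$, fix an integer $p\ge 1$ (truncation order of the Bessel approximation), and put $$\Psi_{i,j}=\tfrac{\beta_i+1}{\alpha_j},\quad b_{k,j}=L_j\mu_j+k,\quad K_{2j}=\frac{\mu_j(1+\kappa_j)D_j^{\alpha_j}}{\varrho_jL_j\bar\gamma_j},\quad K_{1j}(i,k)=\frac{C_i\,V(k,p,L_j\mu_j-1)\,(L_j\mu_j\kappa_j)^{k}}{\alpha_j e^{L_j\mu_j\kappa_j}},$$ $$V(k,p,v)=\frac{\Gamma(p+k)\,p^{1-2k}}{\Gamma(k+1)\Gamma(p-k+1)\Gamma(v+k+1)},$$ where $\bar\gamma_j>0$ is the average SNR. All sums over $i$ run over $1,2,3$ and all sums over $k$ over $0,\dots,p$. With Meijer's $G$-function, the PDF and CDF of the SNR $\gamma_j$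 are given by $$f_{\gamma_j}(\gamma)=\sum_{i,k}K_{1j}(i,k)\,\gamma^{-1}G^{1,1}_{1,2}\!\left[K_{2j}\gamma\,\middle|\begin{matrix}1-\Psi_{i,j}\\ b_{k,j},\,-\Psi_{i,j}\end{matrix}\right],\qquad F_{\gamma_j}(\gamma)=\sum_{i,k}K_{1j}(i,k)\,G^{1,2}_{2,3}\!\left[K_{2j}\gamma\,\middle|\begin{matrix}1-\Psi_{i,j},\,1\\ b_{k,j},\,0,\,-\Psi_{i,j}\end{matrix}\right],$$ and the asymptotic CDF is $$F^\infty_{\gamma_j}(\gamma)=\sum_{i,k}K_{1j}(i,k)(K_{2j}\gamma)^{b_{k,j}}A_j(i,k),\qquad A_j(i,k)=\frac{\Gamma(\Psi_{i,j}+b_{k,j})\Gamma(b_{k,j})}{\Gamma(1+b_{k,j})\Gamma(1+\Psi_{i,j}+b_{k,j})}.$$ For the optical link to the destination $\mathcal D$ let $r\in\{1,2\}$ (detection method), let $\mathcal N\ge1$ be the number of reflecting elements, let $e,v>0$ be the mean and variance of the gain of one element, and let $\tau>0$ be the electrical SNR. Put $\rho=\frac{(\mathcal Ne)^2}{\mathcal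 Nv}$, $w=\frac{\mathcal N v}{\mathcal N e}$, $\Upsilon_5=\frac{r-1}r$, $$\Upsilon_3=\frac{e^{\rho}}{\sqrt r\,\Gamma(\rho)\,w^{\rho}\,\tau^{\rho/r}(2\pi)^{(r-1)/2}},\qquad \Upsilon_4=\frac{e^r}{r^rw^r\tau}.$$ Let $T_1=1$, let $T_2=1-\Upsilon_5$ if $r=2$, and let $T_{r+1}=1+\frac\rho r$. Then $$F_{\gamma_{\mathcal D}}(\gamma)=\Upsilon_3\gamma^{\rho/r}G^{r,1}_{1,r+1}\!\left[\Upsilon_4\gamma\,\middle|\begin{matrix}1-\frac\rho r\\ 1-T_1,\dots,1-T_r,\,-\frac\rho r\end{matrix}\right],$$ $$F^\infty_{\gamma_{\mathcal D}}(\gamma)=\Upsilon_3\gamma^{\rho/r}\sum_{k_2=1}^r(\Upsilon_4\gamma)^{1-T_{k_2}}Q_{k_2},\qquad Q_{k_2}=\frac{\prod_{l\le r,\,l\ne k_2}\Gamma(T_{k_2}-T_l)\;\Gamma(1+\frac\rho r-T_{k_2})}{\Gamma(1+T_{r+1}-T_{k_2})}.$$ For the end-to-end SNR put $F_{\gamma_{eq}}=F_{\gamma_R}+F_{\gamma_{\mathcal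 D}}-F_{\gamma_R}F_{\gamma_{\mathcal D}}$ and $F^\infty_{\gamma_{eq}}=F^\infty_{\gamma_R}+F^\infty_{\gamma_{\mathcal D}}$. Let $\phi=2^{\mathcal R_s}$ with $\mathcal R_s>0$, and let $$SOP^I_L=\int_0^\infty F_{\gamma_{eq}}(\phi\gamma)f_{\gamma_{\mathcal E}}(\gamma)\,d\gamma,\qquad SOP^I_\infty=\int_0^\infty F^\infty_{\gamma_{eq}}(\phi\gamma)f_{\gamma_{\mathcal E}}(\gamma)\,d\gamma .$$ Write $s_{k_2}=\frac\rho r-T_{k_2}+1$ and $$S=\sum_{i,k}K_{1\mathcal E}(i,k)\Bigg(\sum_{i',k'}K_{1R}(i',k')(K_{2R}\phi)^{b_{k',R}}A_R(i',k')\frac{\Gamma(b_{k',R}+b_{k,\mathcal E})}{K_{2\mathcal E}^{\,b_{k',R}}(\Psi_{i,\mathcal E}-b_{k',R})}+\sum_{k_2=1}^{r}\frac{\Upsilon_3\,\phi^{s_{k_2}}}{\Upsilon_4^{\,T_{k_2}-1}}Q_{k_2}\frac{\Gamma(b_{k,\mathcal E}+s_{k_2})\Gamma(\Psi_{i,\mathcal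 E}-s_{k_2})}{K_{2\mathcal E}^{\,s_{k_2}}\Gamma(\Psi_{i,\mathcal E}-s_{k_2}+1)}\Bigg).$$ *Statement.* 1. If $b_{k,R}<\Psi_{i,\mathcal E}$ and $s_{k_2}<\Psi_{i,\mathcal E}$ for all $i$, $0\le k\le p$, $1\le k_2\le r$, then for all $\bar\gamma_R,\tau>0$ the integral $SOP^I_\infty$ converges absolutely and $SOP^I_\infty=S$. 2. The integral $SOP^I_L$ converges absolutely for all $\bar\gamma_R,\tau>0$. 3. If $L_R\mu_R<\Psi_{i,\mathcal E}$ and $\frac\rho r<\Psi_{i,\mathcal E}$ for all $i$, and $b_{k,R}\ne\Psi_{i,\mathcal E}$ and $s_{k_2}\neq\Psi_{i,\mathcal E}$ for all $i$, $0\le k\le p$, $1\le k_2\le r$ (so that no denominator of $S$ vanishes), then $SOP^I_L\sim S$ at high SNR, that is, $SOP^I_L/S\to1$ as $\bar\gamma_R\to\infty$ and $\tau\to\infty$ jointly, with all other parameters fixed. -/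

import Mathlib

open MeasureTheory Set Filter

noncomputable section

/-- The integrand (Mellin transform) of the Meijer function `G^{m,n}_{p,q}` with real parameters.
`a₁` lists the first `n` upper parameters, `a₂` the remaining `p - n` ones; `b₁` lists the first
`m` lower parameters, `b₂` the remaining `q - m` ones. -/
def meijerKernel (a₁ a₂ b₁ b₂ : List ℝ) (s : ℂ) : ℂ :=
  ((b₁.map fun b => Complex.Gamma (b + s)).prod *
      (a₁.map fun a => Complex.Gamma (1 - a - s)).prod) /
    ((b₂.map fun b => Complex.Gamma (1 - b - s)).prod *
      (a₂.map fun a => Complex.Gamma (a + s)).prod)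

/-- The vertical line `Re s = c` separates the poles of the `Γ(b + s)` (which lie to its left)
from those of the `Γ(1 - a - s)` (which lie to its right). -/
def IsSeparatingAbscissa (a₁ b₁ : List ℝ) (c : ℝ) : Prop :=
  (∀ b ∈ b₁, -b < c) ∧ ∀ a ∈ a₁, c < 1 - a

/-- The Meijer function `G^{m,n}_{p,q}[z | a ; b]` with real parameters at a real `z > 0`, as a
Mellin--Barnes integral
`(1 / 2πi) ∫_{c - i∞}^{c + i∞} ∏ Γ(b + s) ∏ Γ(1 - a - s) / (∏ Γ(1 - b - s) ∏ Γ(a + s)) z^{-s} ds`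
along a vertical line that separates the two families of poles (by Cauchy's theorem the choice of
the line is irrelevant). For real parameters the integral is real. It is used here only where such
a line exists and `m + n > (p + q) / 2`, so that the integral converges absolutely. -/
def meijerG (a₁ a₂ b₁ b₂ : List ℝ) (z : ℝ) : ℝ :=
  (mellinInv (Classical.epsilon (IsSeparatingAbscissa a₁ b₁)) (meijerKernel a₁ a₂ b₁ b₂) z).re

/-- Coefficients `C_i` of the density of the distance in the 3D random waypoint model. -/
def rwpC : Fin 3 → ℝ := ![735 / 72, -1190 / 72, 455 / 72]

/-- Exponents `β_i` of the density of the distance in the 3D random waypoint model. -/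
def rwpBeta : Fin 3 → ℝ := ![2, 4, 6]

/-- The coefficients of the polynomial approximation
`I_v(x) ≈ ∑_{k ≤ p} V(k, p, v) (x / 2) ^ (v + 2 k)` of the modified Bessel function. -/
def besselV (k p : ℕ) (v : ℝ) : ℝ :=
  Real.Gamma (p + k) * (p : ℝ) ^ (1 - 2 * (k : ℤ)) /
    (Real.Gamma (k + 1) * Real.Gamma (p - k + 1) * Real.Gamma (v + k + 1))

/-- Parameters of a `κ-μ` faded RF link from the UAV to a receiver with an `L`-branch maximal ratio
combiner: path loss exponent `α`, fading parameters `κ`, `μ`, maximal distance `D`, gain factor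
`ϱ`. The average SNR of a branch is a separate argument below. -/
structure RFLink where
  L : ℕ
  α : ℝ
  κ : ℝ
  μ : ℝ
  D : ℝ
  ϱ : ℝ
  L_pos : 0 < L
  α_pos : 0 < α
  κ_pos : 0 < κ
  μ_pos : 0 < μ
  D_pos : 0 < D
  ϱ_pos : 0 < ϱ

namespace RFLink

variable (j : RFLink)

/-- `Ψ_i = (β_i + 1) / α`. -/
def Psi (i : Fin 3) : ℝ := (rwpBeta i + 1) / j.α

/-- The shape parameter `L μ + k`. -/
def shape (k : ℕ) : ℝ := j.L * j.μ + k

/-- `B = μ (1 + κ)`. -/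
def B : ℝ := j.μ * (1 + j.κ)

/-- `K₁ = C_i V(k, p, L μ - 1) (L μ κ)^k / (α e^{L μ κ})`. -/
def K1 (p : ℕ) (i : Fin 3) (k : ℕ) : ℝ :=
  1 / (j.α * Real.exp (j.L * j.μ * j.κ)) * rwpC i * besselV k p (j.L * j.μ - 1) *
    (j.L * j.μ * j.κ) ^ k

/-- `K₂ = B D^α / (ϱ L γbar)`, where `γbar` is the average SNR. -/
def K2 (γbar : ℝ) : ℝ := j.B * j.D ^ j.α / (j.ϱ * j.L * γbar)

/-- The PDF of the received SNR of the link. -/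
def pdf (p : ℕ) (γbar x : ℝ) : ℝ :=
  ∑ i : Fin 3, ∑ k ∈ Finset.range (p + 1),
    j.K1 p i k * x⁻¹ * meijerG [1 - j.Psi i] [] [j.shape k] [-j.Psi i] (j.K2 γbar * x)

/-- The CDF of the received SNR of the link. -/
def cdf (p : ℕ) (γbar x : ℝ) : ℝ :=
  ∑ i : Fin 3, ∑ k ∈ Finset.range (p + 1),
    j.K1 p i k * meijerG [1 - j.Psi i, 1] [] [j.shape k] [0, -j.Psi i] (j.K2 γbar * x)

/-- The quotient of Gamma values in the asymptotic CDF of the link. -/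
def asympCoeff (i : Fin 3) (k : ℕ) : ℝ :=
  (Real.Gamma (j.Psi i + j.shape k) * Real.Gamma (0 + j.shape k)) /
    (Real.Gamma (1 + j.shape k) * Real.Gamma (1 + j.Psi i + j.shape k))

/-- The asymptotic (high average SNR) CDF of the received SNR of the link. -/
def cdfAsymp (p : ℕ) (γbar x : ℝ) : ℝ :=
  ∑ i : Fin 3, ∑ k ∈ Finset.range (p + 1),
    j.K1 p i k / (j.K2 γbar * x) ^ (-j.shape k) * j.asympCoeff i k

end RFLink

/-- Parameters of the optical link from the relay over the RIS to the destination: the number `N`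
of reflecting elements, mean and variance of the gain `Y_u` of one element, and the detection
method `r` (`1`: heterodyne, `2`: intensity modulation with direct detection). The electrical SNR
`τ` is a separate argument below. -/
structure OpticalLink where
  N : ℕ
  meanY : ℝ
  varY : ℝ
  r : ℕ
  N_pos : 0 < N
  meanY_pos : 0 < meanY
  varY_pos : 0 < varY
  r_eq : r = 1 ∨ r = 2

namespace OpticalLink

variable (d : OpticalLink)

/-- The shape parameter `(𝔼 χ)² / Var χ` of the gamma approximation of `χ = ∑_{u ≤ N} Y_u`. -/
def rho : ℝ := (d.N * d.meanY) ^ 2 / (d.N * d.varY)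

/-- The scale parameter `Var χ / 𝔼 χ` of the gamma approximation of `χ = ∑_{u ≤ N} Y_u`. -/
def w : ℝ := (d.N * d.varY) / (d.N * d.meanY)

def Upsilon3 (τ : ℝ) : ℝ :=
  d.meanY ^ d.rho /
    (Real.sqrt d.r * Real.Gamma d.rho * d.w ^ d.rho * τ ^ (d.rho / d.r) *
      (2 * Real.pi) ^ (((d.r : ℝ) - 1) / 2))

def Upsilon4 (τ : ℝ) : ℝ := d.meanY ^ d.r / ((d.r : ℝ) ^ d.r * d.w ^ d.r * τ)

def Upsilon5 : ℝ := ((d.r : ℝ) - 1) / d.r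

/-- The first `r` lower Meijer parameters: `0` if `r = 1`, and `0, Υ₅` if `r = 2`. -/
def lower (k : Fin d.r) : ℝ := if (k : ℕ) = 0 then 0 else d.Upsilon5

/-- The first `r` entries of `T₃`: `1` if `r = 1`, and `1, 1 - Υ₅` if `r = 2`. -/
def T (k : Fin d.r) : ℝ := 1 - d.lower k

/-- The last entry, number `r + 1`, of `T₃`. -/
def Tlast : ℝ := 1 + d.rho / d.r

/-- The CDF of the SNR at the destination. -/
def cdf (τ x : ℝ) : ℝ :=
  d.Upsilon3 τ * x ^ (d.rho / d.r) *
    meijerG [1 - d.rho / d.r] [] (List.ofFn d.lower) [-(d.rho / d.r)] (d.Upsilon4 τ * x)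

/-- The quotient of Gamma values in the asymptotic CDF of the SNR at the destination. -/
def asympCoeff (k : Fin d.r) : ℝ :=
  ((∏ l ∈ Finset.univ.erase k, Real.Gamma (d.T k - d.T l)) *
      Real.Gamma (1 + d.rho / d.r - d.T k)) /
    Real.Gamma (1 + d.Tlast - d.T k)

/-- The asymptotic (high SNR) CDF of the SNR at the destination. -/
def cdfAsymp (τ x : ℝ) : ℝ :=
  d.Upsilon3 τ * x ^ (d.rho / d.r) *
    ∑ k : Fin d.r, (1 / (d.Upsilon4 τ * x)) ^ (d.T k - 1) * d.asympCoeff k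

end OpticalLink

/-- The CDF of the end-to-end SNR of the dual-hop link. -/
def cdfEq (R : RFLink) (d : OpticalLink) (p : ℕ) (γR τ x : ℝ) : ℝ :=
  R.cdf p γR x + d.cdf τ x - R.cdf p γR x * d.cdf τ x

/-- The asymptotic CDF of the end-to-end SNR of the dual-hop link. -/
def cdfEqAsymp (R : RFLink) (d : OpticalLink) (p : ℕ) (γR τ x : ℝ) : ℝ :=
  R.cdfAsymp p γR x + d.cdfAsymp τ x

/-- The lower bound `∫₀^∞ F_eq(φ γ) f_E(γ) dγ` of the secrecy outage probability when the RF link is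
wiretapped. -/
def sopLower (R E : RFLink) (d : OpticalLink) (p : ℕ) (φ γE γR τ : ℝ) : ℝ :=
  ∫ x in Ioi (0 : ℝ), cdfEq R d p γR τ (φ * x) * E.pdf p γE x

/-- The closed form of the asymptotic secrecy outage probability when the RF link is
wiretapped. -/
def sopClosedForm (R E : RFLink) (d : OpticalLink) (p : ℕ) (φ γE γR τ : ℝ) : ℝ :=
  ∑ i : Fin 3, ∑ k ∈ Finset.range (p + 1), E.K1 p i k *
    ((∑ iR : Fin 3, ∑ kR ∈ Finset.range (p + 1),
        R.K1 p iR kR / (R.K2 γR * φ) ^ (-R.shape kR) * R.asympCoeff iR kR *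
          (Real.Gamma (R.shape kR + E.shape k) /
            (E.K2 γE ^ R.shape kR * (E.Psi i - R.shape kR)))) +
      ∑ k₂ : Fin d.r,
        d.Upsilon3 τ * φ ^ (d.rho / d.r - d.T k₂ + 1) / d.Upsilon4 τ ^ (d.T k₂ - 1) *
          d.asympCoeff k₂ *
          ((Real.Gamma (E.shape k + d.rho / d.r - d.T k₂ + 1) *
              Real.Gamma (E.Psi i - d.rho / d.r + d.T k₂ - 1)) /
            (E.K2 γE ^ (d.rho / d.r - d.T k₂ + 1) *
              Real.Gamma (E.Psi i - d.rho / d.r + d.T k₂))))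

end

/-! Every Meijer function in the statement is an iterated power average of an elementary function.
The quotient `Γ(a - s) / Γ(a - s + 1) = 1 / (a - s)` is the effect on Mellin transforms of `f ↦ ∫₀¹
u ^ (a - 1) f (u x) du`, and the remaining factor is `Γ(b + s)`, the transform of `x ^ b e ^ (-x)`,
or `Γ(s) Γ(s + 1/2)`, which by the duplication formula is the transform of `√π e ^ (-2 √x)`. Mellin
inversion turns this into the identities `meijerG_pdf`, `meijerG_cdf` and `meijerG_zero_half`.

The closed form then comes from moments: the asymptotic CDF is a finite sum of powers `x ^ q`, and
the moment of order `q` of the eavesdropper's density is a Mellin transform at a real point, finite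
for `0 < q < Ψ₀`, where `Ψ₀` is the smallest `Ψ_i` (`integral_rpow_mul_pdf`,
`integral_cdfEqAsymp_mul_pdf`).

For the exact CDFs, a power `q` of the scaled argument is split off. The remaining profile is
bounded on `(0, ∞)` and has a limit at `0+`, as long as `q` does not exceed the leading exponent: `b
= L_R μ_R` for the relay, `a = ρ / r` for the optical link. Small `q` gives absolute convergence.
With `q` equal to the leading exponent, dominated convergence shows that the relay term is `K₂ ^ b`
times a quantity with limit `A`, and the optical term `Υ₃` times one with limit `B`. The product of
the CDFs contributes `K₂ ^ b` times `O(Υ₄ ^ q)` for a small `q > 0`, hence is negligible. The closed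
form has the same two scales and the same limits, its other terms carrying additional positive
powers of `K₂` or `Υ₄`.

Since the two SNRs grow independently, neither scale need dominate. The argument rests on `A, B >
0`, which excludes cancellation (`isEquivalent_of_common_scales`). The coefficients `C_i` have mixed
signs, so this positivity is a property of the mobility model (`sum_rwpC_div_pos`). -/

open scoped Topology

/-! ### Power averages and tame functions -/

/-- The weighted average `∫₀¹ u ^ (a - 1) f (u x) du` of `f` over `(0, x]`. Its Mellin transform at
`s` is that of `f` divided by `a - s`. -/
noncomputable def powerAverage (a : ℝ) (f : ℝ → ℝ) (x : ℝ) : ℝ :=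
  ∫ u in Ioc (0 : ℝ) 1, u ^ (a - 1) * f (u * x)

/-- `f` is measurable, bounded and continuous on `(0, ∞)`, and has the limit `l` at `0+`. -/
structure IsTame (f : ℝ → ℝ) (l : ℝ) : Prop where
  measurable : Measurable f
  bounded : ∃ M, ∀ x, 0 < x → |f x| ≤ M
  continuousOn : ContinuousOn f (Ioi 0)
  tendsto : Tendsto f (𝓝[>] 0) (𝓝 l)

theorem IsTame.const_mul {f : ℝ → ℝ} {l : ℝ} (hf : IsTame f l) (c : ℝ) :
    IsTame (fun x => c * f x) (c * l) := by
  obtain ⟨M, hM⟩ := hf.bounded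
  refine ⟨hf.measurable.const_mul c, ⟨|c| * M, fun x hx => ?_⟩,
    continuousOn_const.mul hf.continuousOn, hf.tendsto.const_mul c⟩
  rw [abs_mul]
  exact mul_le_mul_of_nonneg_left (hM x hx) (abs_nonneg c)

theorem IsTame.sum {ι : Type*} (s : Finset ι) {f : ι → ℝ → ℝ} {l : ι → ℝ}
    (hf : ∀ i ∈ s, IsTame (f i) (l i)) : IsTame (fun x => ∑ i ∈ s, f i x) (∑ i ∈ s, l i) := by
  choose! M hM using fun i hi => (hf i hi).bounded
  refine ⟨Finset.measurable_fun_sum s fun i hi => (hf i hi).measurable,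
    ⟨∑ i ∈ s, M i, fun x hx => ?_⟩, continuousOn_finsetSum s fun i hi => (hf i hi).continuousOn,
    tendsto_finsetSum s fun i hi => (hf i hi).tendsto⟩
  exact (Finset.abs_sum_le_sum_abs _ _).trans (Finset.sum_le_sum fun i hi => hM i hi x hx)

theorem IsTame.comp_mul_rpow {f : ℝ → ℝ} {l : ℝ} (hf : IsTame f l) {c ν : ℝ} (hc : 0 < c)
    (hν : 0 < ν) : IsTame (fun x => f (c * x ^ ν)) l := by
  obtain ⟨M, hM⟩ := hf.bounded
  have hpos : ∀ x : ℝ, 0 < x → 0 < c * x ^ ν := fun x hx => mul_pos hc (Real.rpow_pos_of_pos hx ν)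
  refine ⟨hf.measurable.comp (by fun_prop), ⟨M, fun x hx => hM _ (hpos x hx)⟩,
    hf.continuousOn.comp ?_ fun x hx => hpos x hx, hf.tendsto.comp ?_⟩
  · exact continuousOn_const.mul
      (ContinuousOn.rpow_const continuousOn_id fun x hx => Or.inl (ne_of_gt hx))
  · refine tendsto_nhdsWithin_iff.2 ⟨?_, eventually_nhdsWithin_of_forall fun x hx => hpos x hx⟩
    have : Tendsto (fun x : ℝ => c * x ^ ν) (𝓝 0) (𝓝 (c * 0 ^ ν)) :=
      ((Real.continuousAt_rpow_const 0 ν (Or.inr hν.le)).tendsto).const_mul c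
    rw [Real.zero_rpow hν.ne', mul_zero] at this
    exact this.mono_left nhdsWithin_le_nhds

theorem integrableOn_rpow_Ioc {a : ℝ} (ha : 0 < a) :
    IntegrableOn (fun u : ℝ => u ^ (a - 1)) (Ioc 0 1) :=
  (intervalIntegrable_iff_integrableOn_Ioc_of_le zero_le_one).1
    (intervalIntegral.intervalIntegrable_rpow' (by linarith))

theorem setIntegral_rpow_Ioc {a : ℝ} (ha : 0 < a) :
    ∫ u in Ioc (0 : ℝ) 1, u ^ (a - 1) = 1 / a := by
  rw [← intervalIntegral.integral_of_le zero_le_one, integral_rpow (Or.inl (by linarith))]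
  simp [Real.zero_rpow ha.ne']

theorem measurable_powerAverage (a : ℝ) {f : ℝ → ℝ} (hf : Measurable f) :
    Measurable (powerAverage a f) := by
  have h : StronglyMeasurable (Function.uncurry fun x u : ℝ => u ^ (a - 1) * f (u * x)) :=
    Measurable.stronglyMeasurable (by fun_prop)
  exact h.integral_prod_right'.measurable

theorem powerAverage_congr (a : ℝ) {f g : ℝ → ℝ} (h : ∀ x, 0 < x → f x = g x) {x : ℝ}
    (hx : 0 < x) : powerAverage a f x = powerAverage a g x :=
  setIntegral_congr_fun measurableSet_Ioc fun u hu => by simp only [h _ (mul_pos hu.1 hx)]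

/-- This shift of exponent makes the average usable for `a = 0` when the function vanishes like a
power at `0`, and it is how the leading power of a CDF is split off. -/
theorem powerAverage_rpow_mul (a c : ℝ) (f : ℝ → ℝ) {x : ℝ} (hx : 0 < x) :
    powerAverage a (fun t => t ^ c * f t) x = x ^ c * powerAverage (a + c) f x := by
  simp only [powerAverage, ← integral_const_mul]
  refine setIntegral_congr_fun measurableSet_Ioc fun u hu => ?_
  rw [Real.mul_rpow hu.1.le hx.le, show a + c - 1 = a - 1 + c by ring, Real.rpow_add hu.1]
  ring

/-- Dominated convergence with majorant `u ^ (a - 1) M`. The filter is left general so as to give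
both continuity at a point and the limit at `0+`. -/
theorem tendsto_powerAverage {a : ℝ} (ha : 0 < a) {f F : ℝ → ℝ} {M : ℝ} {l : Filter ℝ}
    [l.IsCountablyGenerated] (hf : Measurable f) (hM : ∀ x, 0 < x → |f x| ≤ M)
    (hl : ∀ᶠ x in l, 0 < x) (hF : ∀ u, 0 < u → Tendsto (fun x => f (u * x)) l (𝓝 (F u))) :
    Tendsto (powerAverage a f) l (𝓝 (∫ u in Ioc (0 : ℝ) 1, u ^ (a - 1) * F u)) := by
  refine tendsto_integral_filter_of_dominated_convergence (fun u => u ^ (a - 1) * M)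
    (Eventually.of_forall fun x => Measurable.aestronglyMeasurable (by fun_prop)) ?_
    ((integrableOn_rpow_Ioc ha).mul_const M) ?_
  · filter_upwards [hl] with x hx
    filter_upwards [ae_restrict_mem measurableSet_Ioc] with u hu
    have hu' := Real.rpow_nonneg hu.1.le (a - 1)
    rw [norm_mul, Real.norm_of_nonneg hu']
    exact mul_le_mul_of_nonneg_left (hM _ (mul_pos hu.1 hx)) hu'
  · filter_upwards [ae_restrict_mem measurableSet_Ioc] with u hu
    exact (hF u hu.1).const_mul _

theorem IsTame.powerAverage {a : ℝ} (ha : 0 < a) {f : ℝ → ℝ} {l : ℝ} (hf : IsTame f l) :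
    IsTame (powerAverage a f) (l / a) := by
  obtain ⟨M, hM⟩ := hf.bounded
  refine ⟨measurable_powerAverage a hf.measurable, ⟨1 / a * M, fun x hx => ?_⟩,
    fun x hx => ?_, ?_⟩
  · rw [← setIntegral_rpow_Ioc ha, ← integral_mul_const, _root_.powerAverage, ← Real.norm_eq_abs]
    refine norm_integral_le_of_norm_le ((integrableOn_rpow_Ioc ha).mul_const M) ?_
    filter_upwards [ae_restrict_mem measurableSet_Ioc] with u hu
    have hu' := Real.rpow_nonneg hu.1.le (a - 1)
    rw [norm_mul, Real.norm_of_nonneg hu']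
    exact mul_le_mul_of_nonneg_left (hM _ (mul_pos hu.1 hx)) hu'
  · refine ContinuousAt.continuousWithinAt ?_
    refine tendsto_powerAverage ha hf.measurable hM (lt_mem_nhds hx) fun u hu => ?_
    have h := hf.continuousOn.continuousAt (Ioi_mem_nhds (mul_pos hu hx))
    exact ContinuousAt.comp (f := fun x => u * x) h (by fun_prop)
  · have := tendsto_powerAverage ha hf.measurable hM self_mem_nhdsWithin (F := fun _ => l)
      (l := 𝓝[>] 0) fun u hu => hf.tendsto.comp <| tendsto_nhdsWithin_iff.2
        ⟨?_, eventually_nhdsWithin_of_forall fun x hx => mul_pos hu hx⟩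
    · rwa [integral_mul_const, setIntegral_rpow_Ioc ha, one_div_mul_eq_div] at this
    · have : Tendsto (fun x : ℝ => u * x) (𝓝 0) (𝓝 (u * 0)) := (continuous_const_mul u).tendsto 0
      rw [mul_zero] at this
      exact this.mono_left nhdsWithin_le_nhds

/-! ### Mellin transform of a power average -/

/-- By Fubini, the inner integral over `x` scales to `u ^ (-s) m`, and `∫₀¹ u ^ (a - s - 1) du = 1 /
(a - s)`. The condition `Re s < a` is the convergence of the latter. -/
theorem hasMellin_powerAverage {a : ℝ} {f : ℝ → ℝ} (hfm : Measurable f) {s m : ℂ}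
    (hf : HasMellin (fun x => (f x : ℂ)) s m) (hs : s.re < a) :
    HasMellin (fun x => (powerAverage a f x : ℂ)) s (m / (a - s)) := by
  obtain ⟨hc, hm⟩ := hf
  have hint : Integrable (Function.uncurry fun x u : ℝ =>
      (x : ℂ) ^ (s - 1) * ((u : ℂ) ^ ((a : ℂ) - 1) * (f (u * x) : ℂ)))
      ((volume.restrict (Ioi 0)).prod (volume.restrict (Ioc 0 1))) := by
    have hmeas : Measurable (Function.uncurry fun x u : ℝ =>
      (x : ℂ) ^ (s - 1) * ((u : ℂ) ^ ((a : ℂ) - 1) * (f (u * x) : ℂ))) := by fun_prop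
    rw [integrable_prod_iff' hmeas.aestronglyMeasurable]
    have hcu : ∀ u ∈ Ioc (0 : ℝ) 1, Integrable (fun x : ℝ => (x : ℂ) ^ (s - 1) * (f (u * x) : ℂ))
        (volume.restrict (Ioi 0)) := fun u hu =>
      (MellinConvergent.comp_mul_left (f := fun x => (f x : ℂ)) (s := s) hu.1).2 hc
    constructor
    · filter_upwards [ae_restrict_mem measurableSet_Ioc] with u hu
      refine ((hcu u hu).const_mul ((u : ℂ) ^ ((a : ℂ) - 1))).congr (Eventually.of_forall fun x => ?_)
      simp only [Function.uncurry]
      ring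
    · refine ((integrableOn_rpow_Ioc (sub_pos.2 hs)).mul_const
        (∫ x in Ioi (0 : ℝ), x ^ (s.re - 1) * |f x|)).congr ?_
      filter_upwards [ae_restrict_mem measurableSet_Ioc] with u hu
      -- The division by `u` inside the power is undone by the substitution `x ↦ u x`, which leaves
      -- the weight `x ^ (Re s - 1)` as it was.
      have h := integral_comp_mul_left_Ioi (fun x : ℝ => (x / u) ^ (s.re - 1) * |f x|) 0 hu.1
      rw [mul_zero] at h
      have h1 : ∫ x in Ioi (0 : ℝ), ‖Function.uncurry (fun x u : ℝ => (x : ℂ) ^ (s - 1) *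
          ((u : ℂ) ^ ((a : ℂ) - 1) * (f (u * x) : ℂ))) (x, u)‖ =
          u ^ (a - 1) * ∫ x in Ioi (0 : ℝ), (u * x / u) ^ (s.re - 1) * |f (u * x)| := by
        rw [← integral_const_mul]
        refine setIntegral_congr_fun measurableSet_Ioi fun x hx => ?_
        simp only [Function.uncurry, norm_mul, Complex.norm_real, Real.norm_eq_abs]
        rw [Complex.norm_cpow_eq_rpow_re_of_pos hx, Complex.norm_cpow_eq_rpow_re_of_pos hu.1,
          mul_div_cancel_left₀ x hu.1.ne']
        simp only [Complex.sub_re, Complex.one_re, Complex.ofReal_re]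
        ring
      rw [h1, h]
      have h2 : ∫ x in Ioi (0 : ℝ), (x / u) ^ (s.re - 1) * |f x| =
          u ^ (1 - s.re) * ∫ x in Ioi (0 : ℝ), x ^ (s.re - 1) * |f x| := by
        rw [← integral_const_mul]
        refine setIntegral_congr_fun measurableSet_Ioi fun x hx => ?_
        rw [Real.div_rpow (le_of_lt hx) hu.1.le, show (1 - s.re) = -(s.re - 1) by ring,
          Real.rpow_neg hu.1.le]
        ring
      rw [h2, smul_eq_mul, show a - s.re - 1 = a - 1 + (-1) + (1 - s.re) by ring,
        Real.rpow_add hu.1, Real.rpow_add hu.1, Real.rpow_neg_one]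
      ring
  have key : ∀ x : ℝ, 0 < x → (x : ℂ) ^ (s - 1) • (powerAverage a f x : ℂ) =
      ∫ u in Ioc (0 : ℝ) 1, (x : ℂ) ^ (s - 1) * ((u : ℂ) ^ ((a : ℂ) - 1) * (f (u * x) : ℂ)) := by
    intro x hx
    rw [integral_const_mul, smul_eq_mul, powerAverage, ← integral_complex_ofReal]
    congr 1
    refine setIntegral_congr_fun measurableSet_Ioc fun u hu => ?_
    simp only [Complex.ofReal_mul, Complex.ofReal_cpow hu.1.le, Complex.ofReal_sub,
      Complex.ofReal_one]
  constructor
  · refine (hint.integral_prod_left).congr ?_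
    filter_upwards [ae_restrict_mem measurableSet_Ioi] with x hx
    exact (key x hx).symm
  · rw [mellin, setIntegral_congr_fun measurableSet_Ioi fun x hx => key x hx,
      integral_integral_swap hint]
    have h : ∀ u ∈ Ioc (0 : ℝ) 1, ∫ x in Ioi (0 : ℝ),
        (x : ℂ) ^ (s - 1) * ((u : ℂ) ^ ((a : ℂ) - 1) * (f (u * x) : ℂ)) =
        (u : ℂ) ^ ((a : ℂ) - s - 1) * m := by
      intro u hu
      have := mellin_comp_mul_left (fun x => (f x : ℂ)) s hu.1
      rw [hm, mellin] at this
      rw [show (a : ℂ) - s - 1 = a - 1 + -s by ring,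
        Complex.cpow_add _ _ (Complex.ofReal_ne_zero.2 hu.1.ne'), mul_assoc, ← smul_eq_mul (_ ^ (-s)),
        ← this, ← integral_const_mul]
      refine setIntegral_congr_fun measurableSet_Ioi fun x hx => ?_
      simp only [smul_eq_mul]
      ring
    have hre : 0 < ((a : ℂ) - s).re := by simpa using hs
    have hne : (a : ℂ) - s ≠ 0 := fun h0 => by simp [h0] at hre
    rw [setIntegral_congr_fun measurableSet_Ioc h, integral_mul_const,
      ← intervalIntegral.integral_of_le zero_le_one,
      integral_cpow (Or.inl (by simpa using hs))]
    simp [Complex.zero_cpow hne]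
    ring

/-! ### Bounds for Gamma and integrability on vertical lines -/

theorem Complex.norm_Gamma_le {s : ℂ} (hs : 0 < s.re) :
    ‖Complex.Gamma s‖ ≤ Real.Gamma s.re := by
  rw [Complex.Gamma_eq_integral hs, Real.Gamma_eq_integral hs, Complex.GammaIntegral]
  refine norm_integral_le_of_norm_le (Real.GammaIntegral_convergent hs) ?_
  filter_upwards [ae_restrict_mem measurableSet_Ioi] with x hx
  rw [norm_mul, Complex.norm_cpow_eq_rpow_re_of_pos hx, Complex.norm_real,
    Real.norm_of_nonneg (Real.exp_pos _).le]
  simp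

theorem Complex.continuousAt_Gamma_of_re_pos {s : ℂ} (hs : 0 < s.re) :
    ContinuousAt Complex.Gamma s :=
  Complex.continuousAt_Gamma s fun m hm => by
    rw [hm] at hs
    simp only [neg_re, natCast_re, Left.neg_pos_iff] at hs
    exact absurd hs (not_lt.2 (Nat.cast_nonneg m))

theorem integrable_inv_sq_add_sq {m : ℝ} (hm : 0 < m) :
    Integrable fun y : ℝ => (m ^ 2 + y ^ 2)⁻¹ := by
  refine ((integrable_inv_one_add_sq.comp_div hm.ne').const_mul (m ^ 2)⁻¹).congr
    (Eventually.of_forall fun y => ?_)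
  simp only
  rw [← mul_inv, div_pow, mul_add, mul_one, mul_div_cancel₀ _ (by positivity)]

/-- Two linear factors in the denominator give decay like `1 / (m ^ 2 + y ^ 2)`, so a bounded
numerator suffices. One factor comes from an average, the other from `Γ(z) = Γ(z + 1) / z`; the
bound `|Γ(z)| ≤ Γ(Re z)` then replaces Stirling's formula. -/
theorem verticalIntegrable_of_eq_div {K g : ℂ → ℂ} {a b c C : ℝ} (hbc : -b < c) (hca : c < a)
    (hK : ∀ s : ℂ, s.re = c → K s = g s / ((b + s) * (a - s)))
    (hg : ∀ s : ℂ, s.re = c → ContinuousAt g s) (hC : ∀ s : ℂ, s.re = c → ‖g s‖ ≤ C) :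
    Complex.VerticalIntegrable K c := by
  -- The distance from the line to the nearer of the two poles `-b` and `a`.
  set m := min (b + c) (a - c)
  have hm : 0 < m := lt_min (by linarith) (by linarith)
  have hre : ∀ y : ℝ, ((c : ℂ) + y * Complex.I).re = c := fun y => by simp
  have hC0 : 0 ≤ C := (norm_nonneg _).trans (hC _ (hre 0))
  have hsq : ∀ (y t : ℝ) (s : ℂ), m ≤ t → s.re = t → (s.im = y ∨ s.im = -y) →
      Real.sqrt (m ^ 2 + y ^ 2) ≤ ‖s‖ := by
    intro y t s ht hs hy
    rw [Complex.norm_eq_sqrt_sq_add_sq]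
    refine Real.sqrt_le_sqrt ?_
    rw [hs]
    have h1 : s.im ^ 2 = y ^ 2 := by rcases hy with h | h <;> rw [h]; ring
    rw [h1]
    gcongr
  have hden : ∀ y : ℝ, m ^ 2 + y ^ 2 ≤
      ‖((b : ℂ) + (c + y * Complex.I)) * (a - (c + y * Complex.I))‖ := by
    intro y
    have h1 := hsq y (b + c) (b + (c + y * Complex.I)) (min_le_left _ _) (by simp) (by simp)
    have h2 := hsq y (a - c) (a - (c + y * Complex.I)) (min_le_right _ _) (by simp) (by simp)
    rw [norm_mul, ← Real.mul_self_sqrt (show 0 ≤ m ^ 2 + y ^ 2 by positivity)]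
    exact mul_le_mul h1 h2 (Real.sqrt_nonneg _) (norm_nonneg _)
  have hden0 : ∀ y : ℝ, ((b : ℂ) + (c + y * Complex.I)) * (a - (c + y * Complex.I)) ≠ 0 :=
    fun y => norm_pos_iff.1 (lt_of_lt_of_le (by positivity) (hden y))
  have hline : Continuous fun y : ℝ => (c : ℂ) + y * Complex.I := by fun_prop
  have hcont : Continuous fun y : ℝ => K (c + y * Complex.I) := by
    simp only [fun y : ℝ => hK _ (hre y)]
    refine Continuous.div (continuous_iff_continuousAt.2 fun y => ?_) (by fun_prop) hden0
    exact ContinuousAt.comp (f := fun y : ℝ => (c : ℂ) + y * Complex.I) (hg _ (hre y))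
      hline.continuousAt
  refine ((integrable_inv_sq_add_sq hm).const_mul C).mono' hcont.aestronglyMeasurable
    (Eventually.of_forall fun y => ?_)
  rw [hK _ (hre y), norm_div, ← div_eq_mul_inv]
  exact div_le_div₀ hC0 (hC _ (hre y)) (by positivity) (hden y)

/-! ### Meijer functions by Mellin inversion -/

/-- In the definition the whole list is coerced to complex numbers, through the list monad; here the
coercion is moved to the entries. -/
theorem meijerKernel_eq (a₁ a₂ b₁ b₂ : List ℝ) (s : ℂ) :
    meijerKernel a₁ a₂ b₁ b₂ s =
      ((b₁.map fun b : ℝ => Complex.Gamma (b + s)).prod *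
          (a₁.map fun a : ℝ => Complex.Gamma (1 - a - s)).prod) /
        ((b₂.map fun b : ℝ => Complex.Gamma (1 - b - s)).prod *
          (a₂.map fun a : ℝ => Complex.Gamma (a + s)).prod) := by
  have h : ∀ l : List ℝ, (l >>= fun a => pure (a : ℂ)) = l.map Complex.ofReal := fun l => by
    rw [← List.flatMap_pure_eq_map]
    rfl
  simp only [meijerKernel, h, List.map_map, Function.comp_def]

/-- The abscissa in `meijerG` is an arbitrary choice, so the transform and its integrability are
required on every separating line. -/
theorem meijerG_eq_of_hasMellin {a₁ a₂ b₁ b₂ : List ℝ} {f : ℝ → ℝ} {z : ℝ} (hz : 0 < z)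
    (hf : ContinuousAt f z) (hex : ∃ c, IsSeparatingAbscissa a₁ b₁ c)
    (hM : ∀ s : ℂ, IsSeparatingAbscissa a₁ b₁ s.re →
      HasMellin (fun x => (f x : ℂ)) s (meijerKernel a₁ a₂ b₁ b₂ s))
    (hV : ∀ c, IsSeparatingAbscissa a₁ b₁ c →
      Complex.VerticalIntegrable (meijerKernel a₁ a₂ b₁ b₂) c) :
    meijerG a₁ a₂ b₁ b₂ z = f z := by
  have hc := Classical.epsilon_spec hex
  rw [meijerG]
  set c := Classical.epsilon (IsSeparatingAbscissa a₁ b₁)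
  have hline : ∀ y : ℝ, mellin (fun x => (f x : ℂ)) (c + y * Complex.I) =
      meijerKernel a₁ a₂ b₁ b₂ (c + y * Complex.I) := fun y => (hM _ (by simpa using hc)).2
  have h1 : mellinInv c (meijerKernel a₁ a₂ b₁ b₂) z =
      mellinInv c (mellin fun x => (f x : ℂ)) z := by
    simp only [mellinInv, hline]
  have h2 : Complex.VerticalIntegrable (mellin fun x => (f x : ℂ)) c := by
    simpa only [Complex.VerticalIntegrable, hline] using hV c hc
  rw [h1, mellinInv_mellin_eq c _ hz (hM c (by simpa using hc)).1 h2
    (Complex.continuous_ofReal.continuousAt.comp hf), Complex.ofReal_re]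

theorem Complex.Gamma_div_Gamma_add_one {s : ℂ} (hs : 0 < s.re) :
    Complex.Gamma s / Complex.Gamma (s + 1) = 1 / s := by
  have h0 : s ≠ 0 := fun h => by simp [h] at hs
  have h := Complex.Gamma_ne_zero_of_re_pos hs
  rw [Complex.Gamma_add_one s h0]
  field_simp

theorem hasMellin_exp_neg {s : ℂ} (hs : 0 < s.re) :
    HasMellin (fun x : ℝ => ((Real.exp (-x) : ℝ) : ℂ)) s (Complex.Gamma s) := by
  refine ⟨(Complex.GammaIntegral_convergent hs).congr (Eventually.of_forall fun x => ?_), ?_⟩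
  · simp only [smul_eq_mul, mul_comm]
  · rw [Complex.Gamma_eq_integral hs, Complex.GammaIntegral_eq_mellin]

theorem HasMellin.congr {f g : ℝ → ℂ} {s m : ℂ} (hf : HasMellin f s m)
    (h : ∀ x, 0 < x → f x = g x) : HasMellin g s m := by
  have h' : EqOn (fun t : ℝ => (t : ℂ) ^ (s - 1) • f t) (fun t : ℝ => (t : ℂ) ^ (s - 1) • g t)
      (Ioi 0) := fun t ht => by simp only [h t ht]
  exact ⟨hf.1.congr_fun h' measurableSet_Ioi,
    (setIntegral_congr_fun measurableSet_Ioi h').symm.trans hf.2⟩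

theorem hasMellin_rpow_mul_exp_neg {b : ℝ} {s : ℂ} (hs : -b < s.re) :
    HasMellin (fun x : ℝ => ((x ^ b * Real.exp (-x) : ℝ) : ℂ)) s (Complex.Gamma (b + s)) := by
  have h := hasMellin_exp_neg (s := s + b) (by simp; linarith)
  have h1 : HasMellin (fun x : ℝ => (x : ℂ) ^ (b : ℂ) • ((Real.exp (-x) : ℝ) : ℂ)) s
      (Complex.Gamma (b + s)) :=
    ⟨MellinConvergent.cpow_smul.2 h.1, by rw [mellin_cpow_smul, h.2, add_comm]⟩
  refine h1.congr fun x hx => ?_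
  rw [smul_eq_mul, ← Complex.ofReal_cpow hx.le, Complex.ofReal_mul]

theorem isTame_rpow_mul_exp_neg {m : ℝ} (hm : 0 ≤ m) :
    IsTame (fun x => x ^ m * Real.exp (-x)) (if m = 0 then 1 else 0) := by
  have hcont : Continuous fun x : ℝ => x ^ m * Real.exp (-x) :=
    (Real.continuous_rpow_const hm).mul (by fun_prop)
  refine ⟨hcont.measurable, ?_, hcont.continuousOn, ?_⟩
  · have h := tendsto_rpow_mul_exp_neg_mul_atTop_nhds_zero m 1 one_pos
    simp only [neg_mul, one_mul] at h
    obtain ⟨A, hA⟩ := eventually_atTop.1 (h.eventually (gt_mem_nhds one_pos))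
    obtain ⟨B, hB⟩ := isCompact_Icc.exists_bound_of_continuousOn
      (hcont.continuousOn (s := Icc 0 A))
    refine ⟨max 1 B, fun x hx => ?_⟩
    rcases le_total A x with h1 | h1
    · rw [abs_of_nonneg (by positivity)]
      exact (hA x h1).le.trans (le_max_left _ _)
    · exact (hB x ⟨hx.le, h1⟩).trans (le_max_right _ _)
  · have h := hcont.tendsto 0
    split_ifs with h0
    · simpa [h0] using h.mono_left nhdsWithin_le_nhds
    · simpa [Real.zero_rpow h0] using h.mono_left nhdsWithin_le_nhds

theorem continuousAt_powerAverage_rpow_mul {a b : ℝ} (hab : 0 < a + b) {f : ℝ → ℝ} {l : ℝ}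
    (hf : IsTame f l) {z : ℝ} (hz : 0 < z) :
    ContinuousAt (powerAverage a fun x => x ^ b * f x) z := by
  have h := ((hf.powerAverage hab).continuousOn.continuousAt (Ioi_mem_nhds hz))
  refine ((Real.continuousAt_rpow_const z b (Or.inl hz.ne')).mul h).congr ?_
  filter_upwards [lt_mem_nhds hz] with x hx
  exact (powerAverage_rpow_mul a b f hx).symm

/-- The kernel collapses to `Γ(b + s) / (Ψ - s)` on the strip `-b < Re s < Ψ`. Only `Ψ + b > 0` is
assumed, so that `b = 0` is included: this is the optical link with `r = 1`. -/
theorem meijerG_pdf {Ψ b : ℝ} (hΨb : 0 < Ψ + b) {z : ℝ} (hz : 0 < z) :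
    meijerG [1 - Ψ] [] [b] [-Ψ] z = powerAverage Ψ (fun x => x ^ b * Real.exp (-x)) z := by
  have hker : ∀ s : ℂ, s.re < Ψ → meijerKernel [1 - Ψ] [] [b] [-Ψ] s =
      Complex.Gamma (b + s) / (Ψ - s) := by
    intro s hs
    have h := Complex.Gamma_div_Gamma_add_one (s := Ψ - s) (by simpa using hs)
    simp only [meijerKernel_eq, List.map_cons, List.map_nil, List.prod_cons, List.prod_nil, mul_one]
    rw [mul_div_assoc, show (1 : ℂ) - ((1 - Ψ : ℝ) : ℂ) - s = Ψ - s by push_cast; ring,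
      show (1 : ℂ) - ((-Ψ : ℝ) : ℂ) - s = Ψ - s + 1 by push_cast; ring, h, mul_one_div]
  have hsep : ∀ c, IsSeparatingAbscissa [1 - Ψ] [b] c ↔ -b < c ∧ c < Ψ := fun c => by
    simp [IsSeparatingAbscissa]
  refine meijerG_eq_of_hasMellin hz (continuousAt_powerAverage_rpow_mul hΨb
    (by simpa using isTame_rpow_mul_exp_neg le_rfl) hz)
    ⟨(Ψ - b) / 2, (hsep _).2 ⟨by linarith, by linarith⟩⟩ (fun s hs => ?_) fun c hc => ?_
  · rw [hsep] at hs
    rw [hker s hs.2]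
    exact hasMellin_powerAverage (by fun_prop) (hasMellin_rpow_mul_exp_neg hs.1) hs.2
  · rw [hsep] at hc
    -- One step of the functional equation supplies the second linear factor `b + s`.
    refine verticalIntegrable_of_eq_div (g := fun s => Complex.Gamma (b + s + 1))
      (C := Real.Gamma (b + c + 1)) hc.1 hc.2 (fun s hs => ?_) (fun s hs => ?_) fun s hs => ?_
    · have h0 : (b : ℂ) + s ≠ 0 := fun h => by
        have := congrArg Complex.re h
        simp [hs] at this
        linarith
      rw [hker s (hs ▸ hc.2), Complex.Gamma_add_one _ h0, mul_div_mul_left _ _ h0]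
    · refine ContinuousAt.comp (f := fun s : ℂ => (b : ℂ) + s + 1)
        (Complex.continuousAt_Gamma_of_re_pos ?_) (by fun_prop)
      simp [hs]; linarith
    · have h := Complex.norm_Gamma_le (s := b + s + 1) (by simp [hs]; linarith)
      simpa [hs] using h

/-- The additional quotient `Γ(-s) / Γ(1 - s) = 1 / (0 - s)` is an average with exponent `0`, that
is, integration of `x⁻¹` times the inner function from `0`. It confines the strip to `Re s < 0`. -/
theorem meijerG_cdf {Ψ b : ℝ} (hΨ : 0 < Ψ) (hb : 0 < b) {z : ℝ} (hz : 0 < z) :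
    meijerG [1 - Ψ, 1] [] [b] [0, -Ψ] z =
      powerAverage 0 (powerAverage Ψ fun x => x ^ b * Real.exp (-x)) z := by
  have hker : ∀ s : ℂ, s.re < Ψ → s.re < 0 → meijerKernel [1 - Ψ, 1] [] [b] [0, -Ψ] s =
      Complex.Gamma (b + s) / (Ψ - s) / ((0 : ℝ) - s) := by
    intro s hs hs0
    have h := Complex.Gamma_div_Gamma_add_one (s := Ψ - s) (by simpa using hs)
    have h' := Complex.Gamma_div_Gamma_add_one (s := -s) (by simpa using hs0)
    simp only [meijerKernel_eq, List.map_cons, List.map_nil, List.prod_cons, List.prod_nil, mul_one]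
    rw [show (1 : ℂ) - ((1 - Ψ : ℝ) : ℂ) - s = Ψ - s by push_cast; ring,
      show (1 : ℂ) - ((-Ψ : ℝ) : ℂ) - s = Ψ - s + 1 by push_cast; ring,
      show (1 : ℂ) - ((1 : ℝ) : ℂ) - s = -s by push_cast; ring,
      show (1 : ℂ) - ((0 : ℝ) : ℂ) - s = -s + 1 by push_cast; ring,
      mul_comm (Complex.Gamma (-s + 1)), mul_div_assoc, mul_div_mul_comm, h, h']
    push_cast
    rw [zero_sub, mul_one_div, mul_div_assoc', mul_one_div]
  have hsep : ∀ c, IsSeparatingAbscissa [1 - Ψ, 1] [b] c ↔ -b < c ∧ c < Ψ ∧ c < 0 := fun c => by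
    simp [IsSeparatingAbscissa]
  have hin : ∀ x, 0 < x → powerAverage Ψ (fun x => x ^ b * Real.exp (-x)) x =
      x ^ b * powerAverage (Ψ + b) (fun x => Real.exp (-x)) x := fun x hx =>
    powerAverage_rpow_mul Ψ b _ hx
  have hexp : IsTame (fun x => Real.exp (-x)) 1 := by simpa using isTame_rpow_mul_exp_neg le_rfl
  refine meijerG_eq_of_hasMellin hz ?_
    ⟨-b / 2, (hsep _).2 ⟨by linarith, by linarith, by linarith⟩⟩ (fun s hs => ?_) fun c hc => ?_
  · refine (continuousAt_powerAverage_rpow_mul (a := 0) (b := b) (by linarith)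
      (hexp.powerAverage (a := Ψ + b) (by linarith)) hz).congr ?_
    filter_upwards [lt_mem_nhds hz] with x hx
    exact (powerAverage_congr 0 hin hx).symm
  · rw [hsep] at hs
    rw [hker s hs.2.1 hs.2.2]
    exact hasMellin_powerAverage (measurable_powerAverage _ (by fun_prop))
      (hasMellin_powerAverage (by fun_prop) (hasMellin_rpow_mul_exp_neg hs.1) hs.2.1) hs.2.2
  · rw [hsep] at hc
    have hne : ∀ s : ℂ, s.re = c → (0 : ℝ) - s ≠ 0 := fun s hs h => by
      have := congrArg Complex.re h
      simp [hs] at this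
      linarith
    -- The third linear factor is not needed for decay; it goes into the numerator, with `|0 - s| ≥
    -- |c|`.
    refine verticalIntegrable_of_eq_div (g := fun s => Complex.Gamma (b + s + 1) / ((0 : ℝ) - s))
      (C := Real.Gamma (b + c + 1) / |c|) hc.1 hc.2.1 (fun s hs => ?_) (fun s hs => ?_)
      fun s hs => ?_
    · have h0 : (b : ℂ) + s ≠ 0 := fun h => by
        have := congrArg Complex.re h
        simp [hs] at this
        linarith
      rw [hker s (hs ▸ hc.2.1) (hs ▸ hc.2.2), Complex.Gamma_add_one _ h0, div_right_comm _ _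
        (_ * _), mul_div_mul_left _ _ h0]
    · refine ContinuousAt.div (ContinuousAt.comp (f := fun s : ℂ => (b : ℂ) + s + 1)
        (Complex.continuousAt_Gamma_of_re_pos ?_) (by fun_prop)) (by fun_prop) (hne s hs)
      simp [hs]; linarith
    · have h := Complex.norm_Gamma_le (s := b + s + 1) (by simp [hs]; linarith)
      rw [norm_div]
      refine div_le_div₀ (Real.Gamma_pos_of_pos (by linarith)).le (by simpa [hs] using h)
        (abs_pos.2 hc.2.2.ne) ?_
      have h2 := Complex.abs_re_le_norm ((0 : ℝ) - s)
      simpa [hs] using h2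

theorem hasMellin_exp_neg_two_mul_sqrt {s : ℂ} (hs : 0 < s.re) :
    HasMellin (fun x : ℝ => ((Real.sqrt Real.pi * Real.exp (-(2 * x ^ (1 / 2 : ℝ))) : ℝ) : ℂ)) s
      (Complex.Gamma s * Complex.Gamma (s + 1 / 2)) := by
  have h := hasMellin_exp_neg (s := 2 * s) (by simpa using hs)
  have e : s / ((1 / 2 : ℝ) : ℂ) = 2 * s := by
    push_cast
    ring
  have h1 := (MellinConvergent.comp_mul_left (f := fun x : ℝ => ((Real.exp (-x) : ℝ) : ℂ))
    (s := 2 * s) two_pos).2 h.1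
  have h2 := mellin_comp_mul_left (fun x : ℝ => ((Real.exp (-x) : ℝ) : ℂ)) (2 * s) two_pos
  have h3 := (MellinConvergent.comp_rpow (f := fun x : ℝ => ((Real.exp (-(2 * x)) : ℝ) : ℂ))
    (s := s) (a := 1 / 2) (by norm_num)).2 (by rwa [e])
  have h4 := mellin_comp_rpow (fun x : ℝ => ((Real.exp (-(2 * x)) : ℝ) : ℂ)) s (1 / 2)
  have h5 := hasMellin_const_smul h3 (Real.sqrt Real.pi : ℂ)
  simp only [smul_eq_mul] at h5
  rw [h4, e, h2, h.2] at h5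
  -- Legendre's duplication formula; the factor `|1/2|⁻¹ = 2` comes from the substitution `x ↦ x ^
  -- (1/2)`.
  have e2 : (Real.sqrt Real.pi : ℂ) * (|(1 / 2 : ℝ)|⁻¹ • ((2 : ℝ) : ℂ) ^ (-(2 * s)) •
      Complex.Gamma (2 * s)) = Complex.Gamma s * Complex.Gamma (s + 1 / 2) := by
    rw [Complex.Gamma_mul_Gamma_add_half, sub_eq_add_neg, Complex.cpow_add _ _ two_ne_zero,
      Complex.cpow_one, abs_of_pos (by norm_num : (0 : ℝ) < 1 / 2), Complex.real_smul]
    push_cast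
    rw [smul_eq_mul]
    ring
  rw [e2] at h5
  exact h5.congr fun x _ => by push_cast; rfl

theorem isTame_rpow_mul_exp_neg_rpow {m r : ℝ} (hm : 0 ≤ m) (hr : 0 < r) :
    IsTame (fun x => x ^ m * Real.exp (-(r * x ^ (1 / r)))) (if m = 0 then 1 else 0) := by
  -- Substituting `y = r x ^ (1 / r)` gives `y ^ (r m) = r ^ (r m) x ^ m`, which reduces to the pure
  -- exponential.
  have h := ((isTame_rpow_mul_exp_neg (m := r * m) (by positivity)).comp_mul_rpow hr
    (one_div_pos.2 hr)).const_mul (r ^ (r * m))⁻¹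
  have hfun : EqOn (fun x : ℝ => x ^ m * Real.exp (-(r * x ^ (1 / r)))) (fun x : ℝ =>
      (r ^ (r * m))⁻¹ * ((r * x ^ (1 / r)) ^ (r * m) * Real.exp (-(r * x ^ (1 / r))))) (Ioi 0) := by
    intro x hx
    have hx' : (0 : ℝ) < x := hx
    have h0 : r ^ (r * m) ≠ 0 := (Real.rpow_pos_of_pos hr _).ne'
    have e : (x ^ (1 / r)) ^ (r * m) = x ^ m := by
      rw [← Real.rpow_mul hx'.le]
      congr 1
      field_simp
    beta_reduce
    rw [Real.mul_rpow hr.le (by positivity), e]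
    field_simp
  obtain ⟨M, hM⟩ := h.bounded
  refine ⟨by fun_prop, ⟨M, fun x hx => ?_⟩, h.continuousOn.congr hfun, ?_⟩
  · exact (congrArg abs (hfun hx)).le.trans (hM x hx)
  · have h2 := h.tendsto.congr' (eventuallyEq_of_mem self_mem_nhdsWithin hfun.symm)
    convert! h2 using 2
    by_cases h0 : m = 0
    · simp [h0]
    · simp [h0, hr.ne']

theorem meijerG_zero_half {a : ℝ} (ha : 0 < a) {z : ℝ} (hz : 0 < z) :
    meijerG [1 - a] [] [0, 1 / 2] [-a] z = powerAverage a
      (fun x => Real.sqrt Real.pi * Real.exp (-(2 * x ^ (1 / 2 : ℝ)))) z := by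
  have hker : ∀ s : ℂ, s.re < a → meijerKernel [1 - a] [] [0, 1 / 2] [-a] s =
      Complex.Gamma s * Complex.Gamma (s + 1 / 2) / (a - s) := by
    intro s hs
    have h := Complex.Gamma_div_Gamma_add_one (s := a - s) (by simpa using hs)
    simp only [meijerKernel_eq, List.map_cons, List.map_nil, List.prod_cons, List.prod_nil,
      mul_one]
    rw [mul_div_assoc, show (1 : ℂ) - ((1 - a : ℝ) : ℂ) - s = a - s by push_cast; ring,
      show (1 : ℂ) - ((-a : ℝ) : ℂ) - s = a - s + 1 by push_cast; ring, h, mul_one_div,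
      show ((0 : ℝ) : ℂ) + s = s by simp,
      show ((1 / 2 : ℝ) : ℂ) + s = s + 1 / 2 by push_cast; ring]
  have hsep : ∀ c, IsSeparatingAbscissa [1 - a] [0, 1 / 2] c ↔ 0 < c ∧ c < a := fun c => by
    simp [IsSeparatingAbscissa]
    intros
    linarith
  have htame := ((isTame_rpow_mul_exp_neg_rpow (m := 0) (r := 2) le_rfl two_pos).const_mul
    (Real.sqrt Real.pi))
  simp only [Real.rpow_zero, one_mul] at htame
  refine meijerG_eq_of_hasMellin hz
    ((htame.powerAverage ha).continuousOn.continuousAt (Ioi_mem_nhds hz))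
    ⟨a / 2, (hsep _).2 ⟨by linarith, by linarith⟩⟩ (fun s hs => ?_) fun c hc => ?_
  · rw [hsep] at hs
    rw [hker s hs.2]
    exact hasMellin_powerAverage htame.measurable (hasMellin_exp_neg_two_mul_sqrt hs.1) hs.2
  · rw [hsep] at hc
    refine verticalIntegrable_of_eq_div (b := 0)
      (g := fun s => Complex.Gamma (s + 1) * Complex.Gamma (s + 1 / 2))
      (C := Real.Gamma (c + 1) * Real.Gamma (c + 1 / 2)) (by linarith) hc.2 (fun s hs => ?_)
      (fun s hs => ?_) fun s hs => ?_
    · have h0 : s ≠ 0 := fun h => by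
        rw [h] at hs
        exact hc.1.ne hs
      rw [hker s (hs ▸ hc.2), Complex.Gamma_add_one _ h0, Complex.ofReal_zero, zero_add,
        mul_assoc s, mul_div_mul_left _ _ h0]
    · refine ContinuousAt.mul (ContinuousAt.comp (f := fun s : ℂ => s + 1)
        (Complex.continuousAt_Gamma_of_re_pos ?_) (by fun_prop))
        (ContinuousAt.comp (f := fun s : ℂ => s + 1 / 2)
        (Complex.continuousAt_Gamma_of_re_pos ?_) (by fun_prop))
      all_goals simp [hs]; linarith
    · have h := Complex.norm_Gamma_le (s := s + 1) (by simp [hs]; linarith)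
      have h' := Complex.norm_Gamma_le (s := s + 1 / 2) (by simp [hs]; linarith)
      rw [norm_mul]
      refine mul_le_mul (by simpa [hs] using h) (by simpa [hs] using h') (norm_nonneg _)
        (Real.Gamma_pos_of_pos (by linarith)).le

/-! ### The optical CDF in elementary form -/

namespace OpticalLink

variable (d : OpticalLink)

/-- The function with Mellin transform `∏ Γ(b + s)`, where `b` runs over `d.lower`. -/
noncomputable def decay (x : ℝ) : ℝ :=
  (if d.r = 1 then 1 else Real.sqrt Real.pi) * Real.exp (-(d.r * x ^ (1 / d.r : ℝ)))

theorem r_pos : (0 : ℝ) < d.r := by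
  rcases d.r_eq with h | h <;> simp [h]

theorem rho_pos : 0 < d.rho := by
  have := d.N_pos
  have := d.meanY_pos
  have := d.varY_pos
  unfold rho
  positivity

theorem rho_div_r_pos : 0 < d.rho / d.r := div_pos d.rho_pos d.r_pos

theorem w_pos : 0 < d.w := by
  have := d.N_pos
  have := d.meanY_pos
  have := d.varY_pos
  unfold w
  positivity

theorem Upsilon4_pos {τ : ℝ} (hτ : 0 < τ) : 0 < d.Upsilon4 τ := by
  have := d.r_pos
  have := d.w_pos
  have := d.meanY_pos
  unfold Upsilon4
  positivity

theorem Upsilon3_pos {τ : ℝ} (hτ : 0 < τ) : 0 < d.Upsilon3 τ := by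
  have := d.r_pos
  have := d.w_pos
  have := d.meanY_pos
  have := Real.Gamma_pos_of_pos d.rho_pos
  have := Real.pi_pos
  unfold Upsilon3
  positivity

theorem cdf_eq {τ x : ℝ} (hτ : 0 < τ) (hx : 0 < x) :
    d.cdf τ x = d.Upsilon3 τ * x ^ (d.rho / d.r) *
      powerAverage (d.rho / d.r) d.decay (d.Upsilon4 τ * x) := by
  have hz := mul_pos (d.Upsilon4_pos hτ) hx
  have ha := d.rho_div_r_pos
  rw [cdf]
  congr 1
  rcases d.r_eq with h | h
  · have e : List.ofFn d.lower = [0] := by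
      rw [List.ofFn_congr h]
      simp [lower]
    rw [e, meijerG_pdf (by linarith) hz]
    congr 1
    ext x
    simp [decay, h]
  · have e : List.ofFn d.lower = [0, 1 / 2] := by
      rw [List.ofFn_congr h]
      simp [lower, Upsilon5, h]
      norm_num
    rw [e, meijerG_zero_half ha hz]
    congr 1
    ext x
    simp [decay, h]

theorem isTame_rpow_mul_decay {m : ℝ} (hm : 0 ≤ m) : ∃ l, IsTame (fun x => x ^ m * d.decay x) l := by
  refine ⟨_, (?_ : IsTame _ ((if d.r = 1 then 1 else Real.sqrt Real.pi) * (if m = 0 then 1 else 0)))⟩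
  have := (isTame_rpow_mul_exp_neg_rpow hm d.r_pos).const_mul
    (if d.r = 1 then 1 else Real.sqrt Real.pi)
  refine (congrArg (IsTame · _) ?_).mp this
  ext x
  rw [decay]
  ring

theorem isTame_decay : IsTame d.decay (if d.r = 1 then 1 else Real.sqrt Real.pi) := by
  have := (isTame_rpow_mul_exp_neg_rpow le_rfl d.r_pos).const_mul
    (if d.r = 1 then 1 else Real.sqrt Real.pi)
  simp only [Real.rpow_zero, one_mul, if_true, mul_one] at this
  exact this

end OpticalLink

/-! ### Moments of the SNR of an RF link -/

theorem HasMellin.integral_ofReal {f : ℝ → ℝ} {q m : ℝ}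
    (h : HasMellin (fun x => (f x : ℂ)) (q : ℂ) (m : ℂ)) :
    IntegrableOn (fun x => x ^ (q - 1) * f x) (Ioi 0) ∧
      ∫ x in Ioi (0 : ℝ), x ^ (q - 1) * f x = m := by
  have e : EqOn (fun x : ℝ => (x : ℂ) ^ ((q : ℂ) - 1) • (f x : ℂ))
      (fun x : ℝ => ((x ^ (q - 1) * f x : ℝ) : ℂ)) (Ioi 0) := fun x hx => by
    simp only [smul_eq_mul, Complex.ofReal_mul, Complex.ofReal_cpow (le_of_lt hx),
      Complex.ofReal_sub, Complex.ofReal_one]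
  constructor
  · have h1 : IntegrableOn (fun x : ℝ => ((x ^ (q - 1) * f x : ℝ) : ℂ)) (Ioi 0) :=
      h.1.congr_fun e measurableSet_Ioi
    have h2 := h1.re
    simp only [RCLike.re_to_complex, Complex.ofReal_re] at h2
    exact h2
  · have h1 := h.2
    rw [mellin, setIntegral_congr_fun measurableSet_Ioi e, integral_complex_ofReal] at h1
    exact_mod_cast h1

/-- A Mellin transform at the real point `q`, since `x ^ q x⁻¹` is the Mellin weight; the factor `K
^ (-q)` comes from scaling. -/
theorem integral_rpow_mul_powerAverage {Ψ b q K : ℝ} (hb : -b < q) (hΨ : q < Ψ) (hK : 0 < K) :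
    IntegrableOn (fun x => x ^ q * (x⁻¹ *
        powerAverage Ψ (fun t => t ^ b * Real.exp (-t)) (K * x))) (Ioi 0) ∧
      ∫ x in Ioi (0 : ℝ), x ^ q * (x⁻¹ *
        powerAverage Ψ (fun t => t ^ b * Real.exp (-t)) (K * x)) =
          Real.Gamma (q + b) / (K ^ q * (Ψ - q)) := by
  have h := hasMellin_powerAverage (a := Ψ) (s := (q : ℂ)) (by fun_prop)
    (hasMellin_rpow_mul_exp_neg (b := b) (by simpa using hb)) (by simpa using hΨ)
  have h1 := (MellinConvergent.comp_mul_left (f := fun x =>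
    (powerAverage Ψ (fun t => t ^ b * Real.exp (-t)) x : ℂ)) hK).2 h.1
  have h2 := mellin_comp_mul_left (fun x =>
    (powerAverage Ψ (fun t => t ^ b * Real.exp (-t)) x : ℂ)) (q : ℂ) hK
  rw [h.2] at h2
  have h3 : (K : ℂ) ^ (-(q : ℂ)) • (Complex.Gamma (b + q) / (Ψ - q)) =
      ((Real.Gamma (q + b) / (K ^ q * (Ψ - q)) : ℝ) : ℂ) := by
    rw [smul_eq_mul, Complex.cpow_neg, ← Complex.ofReal_cpow hK.le]
    push_cast [← Complex.Gamma_ofReal]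
    rw [add_comm (b : ℂ), inv_mul_eq_div, div_div, mul_comm ((Ψ : ℂ) - q)]
  have h4 := HasMellin.integral_ofReal
    (f := fun x => powerAverage Ψ (fun t => t ^ b * Real.exp (-t)) (K * x)) ⟨h1, h2.trans h3⟩
  have e : EqOn (fun x : ℝ => x ^ (q - 1) *
      powerAverage Ψ (fun t => t ^ b * Real.exp (-t)) (K * x)) (fun x : ℝ => x ^ q * (x⁻¹ *
        powerAverage Ψ (fun t => t ^ b * Real.exp (-t)) (K * x))) (Ioi 0) := fun x hx => by
    beta_reduce
    rw [Real.rpow_sub_one (ne_of_gt hx)]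
    ring
  exact ⟨h4.1.congr_fun e measurableSet_Ioi,
    (setIntegral_congr_fun measurableSet_Ioi e).symm.trans h4.2⟩

namespace RFLink

variable (j : RFLink)

theorem Psi_pos (i : Fin 3) : 0 < j.Psi i := by
  have := j.α_pos
  fin_cases i <;> simp [Psi, rwpBeta] <;> positivity

theorem Psi_zero_le (i : Fin 3) : j.Psi 0 ≤ j.Psi i := by
  have := j.α_pos
  unfold Psi
  gcongr
  fin_cases i <;> simp [rwpBeta] <;> norm_num

theorem shape_zero_pos : 0 < j.shape 0 := by
  have h1 : (0 : ℝ) < j.L := by exact_mod_cast j.L_pos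
  have := j.μ_pos
  simp only [shape, Nat.cast_zero, add_zero]
  positivity

theorem shape_eq (k : ℕ) : j.shape k = j.shape 0 + k := by
  simp [shape]

theorem shape_zero_le (k : ℕ) : j.shape 0 ≤ j.shape k := by
  simp [shape]

theorem shape_pos (k : ℕ) : 0 < j.shape k := j.shape_zero_pos.trans_le (j.shape_zero_le k)

theorem K2_pos {γ : ℝ} (hγ : 0 < γ) : 0 < j.K2 γ := by
  have h1 : (0 : ℝ) < j.L := by exact_mod_cast j.L_pos
  have := j.μ_pos
  have := j.κ_pos
  have := j.D_pos
  have := j.ϱ_pos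
  unfold K2 B
  positivity

/-- The factor of `K₁` that does not depend on the mobility model. -/
noncomputable def fadingCoeff (p k : ℕ) : ℝ :=
  1 / (j.α * Real.exp (j.L * j.μ * j.κ)) * besselV k p (j.L * j.μ - 1) * (j.L * j.μ * j.κ) ^ k

theorem K1_eq (p : ℕ) (i : Fin 3) (k : ℕ) : j.K1 p i k = rwpC i * j.fadingCoeff p k := by
  unfold K1 fadingCoeff
  ring

theorem fadingCoeff_pos {p k : ℕ} (hp : 1 ≤ p) (hk : k ∈ Finset.range (p + 1)) :
    0 < j.fadingCoeff p k := by
  have h1 : (0 : ℝ) < j.L := by exact_mod_cast j.L_pos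
  have h2 := j.μ_pos
  have := j.κ_pos
  have := j.α_pos
  have hp' : (0 : ℝ) < p := by exact_mod_cast hp
  have hk' : (k : ℝ) ≤ p := by exact_mod_cast Nat.lt_succ_iff.1 (Finset.mem_range.1 hk)
  have := Real.Gamma_pos_of_pos (show (0 : ℝ) < p + k by positivity)
  have := Real.Gamma_pos_of_pos (show (0 : ℝ) < k + 1 by positivity)
  have := Real.Gamma_pos_of_pos (show (0 : ℝ) < p - k + 1 by linarith)
  have := Real.Gamma_pos_of_pos (show (0 : ℝ) < j.L * j.μ - 1 + k + 1 by
    have : 0 < j.L * j.μ := by positivity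
    have : (0 : ℝ) ≤ k := by positivity
    linarith)
  unfold fadingCoeff besselV
  positivity

/-- Up to positive factors the sum is a moment of the density `∑ C_i u ^ β_i` of the distance on
`(0, 1)`, hence positive although `C_2 < 0`. -/
theorem sum_rwpC_div_pos {y : ℝ} (hy : -j.Psi 0 < y) : 0 < ∑ i, rwpC i / (j.Psi i + y) := by
  have hα := j.α_pos
  have h0 : 0 < 3 + j.α * y := by
    have h : j.Psi 0 = 3 / j.α := by simp [Psi, rwpBeta]; norm_num
    rw [h, neg_lt_iff_pos_add', div_add' _ _ _ hα.ne'] at hy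
    have := (div_pos_iff_of_pos_right hα).1 hy
    linarith
  have e : ∀ i, rwpC i / (j.Psi i + y) = j.α * (rwpC i / (rwpBeta i + 1 + j.α * y)) := by
    intro i
    rw [Psi, div_add' _ _ _ hα.ne', div_div_eq_mul_div]
    ring
  simp only [e, ← Finset.mul_sum]
  refine mul_pos hα ?_
  simp only [Fin.sum_univ_three, rwpC, rwpBeta, Matrix.cons_val]
  have h1 : 0 < 2 + 1 + j.α * y := by linarith
  have h2 : 0 < 4 + 1 + j.α * y := by linarith
  have h3 : 0 < 6 + 1 + j.α * y := by linarith
  rw [div_add_div _ _ h1.ne' h2.ne', div_add_div _ _ (mul_pos h1 h2).ne' h3.ne']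
  refine div_pos ?_ (by positivity)
  -- With `t = 3 + α y` the quadratic terms cancel and the numerator is `(560 t + 5880) / 72`.
  nlinarith

theorem pdf_eq (p : ℕ) {γ x : ℝ} (hγ : 0 < γ) (hx : 0 < x) :
    j.pdf p γ x = ∑ i, ∑ k ∈ Finset.range (p + 1), j.K1 p i k * (x⁻¹ *
      powerAverage (j.Psi i) (fun t => t ^ j.shape k * Real.exp (-t)) (j.K2 γ * x)) := by
  unfold pdf
  refine Finset.sum_congr rfl fun i _ => Finset.sum_congr rfl fun k _ => ?_
  rw [meijerG_pdf (add_pos (j.Psi_pos i) (j.shape_pos k)) (mul_pos (j.K2_pos hγ) hx), mul_assoc]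

/-- The moment of order `q` of the SNR of the link. -/
noncomputable def moment (p : ℕ) (γ q : ℝ) : ℝ :=
  ∑ i, ∑ k ∈ Finset.range (p + 1),
    j.K1 p i k * (Real.Gamma (q + j.shape k) / (j.K2 γ ^ q * (j.Psi i - q)))

theorem integral_rpow_mul_pdf (p : ℕ) {γ q : ℝ} (hγ : 0 < γ) (hq : 0 < q) (hΨ : q < j.Psi 0) :
    IntegrableOn (fun x => x ^ q * j.pdf p γ x) (Ioi 0) ∧
      ∫ x in Ioi (0 : ℝ), x ^ q * j.pdf p γ x = j.moment p γ q := by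
  have h := fun i k => integral_rpow_mul_powerAverage (Ψ := j.Psi i) (b := j.shape k) (q := q)
    (by linarith [j.shape_pos k]) (hΨ.trans_le (j.Psi_zero_le i)) (j.K2_pos hγ)
  have e : EqOn (fun x => ∑ i, ∑ k ∈ Finset.range (p + 1), j.K1 p i k * (x ^ q * (x⁻¹ *
      powerAverage (j.Psi i) (fun t => t ^ j.shape k * Real.exp (-t)) (j.K2 γ * x))))
      (fun x => x ^ q * j.pdf p γ x) (Ioi 0) := fun x hx => by
    beta_reduce
    rw [j.pdf_eq p hγ hx]
    simp only [Finset.mul_sum]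
    refine Finset.sum_congr rfl fun i _ => Finset.sum_congr rfl fun k _ => ?_
    ring
  have hi : ∀ i, ∀ k ∈ Finset.range (p + 1), IntegrableOn (fun x => j.K1 p i k * (x ^ q * (x⁻¹ *
      powerAverage (j.Psi i) (fun t => t ^ j.shape k * Real.exp (-t)) (j.K2 γ * x)))) (Ioi 0) :=
    fun i k _ => (h i k).1.const_mul _
  constructor
  · exact IntegrableOn.congr_fun (integrable_finsetSum _ fun i _ =>
      integrable_finsetSum _ fun k hk => hi i k hk) e measurableSet_Ioi
  · rw [← setIntegral_congr_fun measurableSet_Ioi e, integral_finsetSum _ fun i _ =>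
      integrable_finsetSum _ fun k hk => hi i k hk, moment]
    refine Finset.sum_congr rfl fun i _ => ?_
    rw [integral_finsetSum _ fun k hk => hi i k hk]
    refine Finset.sum_congr rfl fun k _ => ?_
    rw [integral_const_mul, (h i k).2]

/-- The dependence on `i` factors out of the double sum, which confines the signs to
`sum_rwpC_div_pos`; the sum over `k` has positive terms. -/
theorem moment_pos {p : ℕ} (hp : 1 ≤ p) {γ q : ℝ} (hγ : 0 < γ) (hq : 0 < q)
    (hΨ : q < j.Psi 0) : 0 < j.moment p γ q := by
  have e : j.moment p γ q = (∑ i, rwpC i / (j.Psi i + -q)) * ∑ k ∈ Finset.range (p + 1),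
      j.fadingCoeff p k * (Real.Gamma (q + j.shape k) / j.K2 γ ^ q) := by
    rw [moment, Finset.sum_mul_sum]
    refine Finset.sum_congr rfl fun i _ => Finset.sum_congr rfl fun k _ => ?_
    rw [j.K1_eq, ← sub_eq_add_neg, ← div_div]
    ring
  rw [e]
  refine mul_pos (j.sum_rwpC_div_pos (by linarith)) (Finset.sum_pos (fun k hk => ?_) (by simp))
  exact mul_pos (j.fadingCoeff_pos hp hk) (div_pos
    (Real.Gamma_pos_of_pos (add_pos hq (j.shape_pos k))) (Real.rpow_pos_of_pos (j.K2_pos hγ) q))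

/-! ### Profiles of the CDFs and their limits at zero -/

/-- The CDF of the link divided by the power `q` of its argument, at unit average SNR. -/
noncomputable def cdfProfile (p : ℕ) (q z : ℝ) : ℝ :=
  ∑ i, ∑ k ∈ Finset.range (p + 1), j.K1 p i k *
    powerAverage q (powerAverage (j.Psi i + q) fun t => t ^ (j.shape k - q) * Real.exp (-t)) z

theorem cdf_eq (p : ℕ) (q : ℝ) {γ x : ℝ} (hγ : 0 < γ) (hx : 0 < x) :
    j.cdf p γ x = (j.K2 γ * x) ^ q * j.cdfProfile p q (j.K2 γ * x) := by
  have hz := mul_pos (j.K2_pos hγ) hx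
  simp only [cdf, cdfProfile, Finset.mul_sum]
  refine Finset.sum_congr rfl fun i _ => Finset.sum_congr rfl fun k _ => ?_
  rw [meijerG_cdf (j.Psi_pos i) (j.shape_pos k) hz, powerAverage_congr 0 (g := fun x => x ^ q *
    powerAverage (j.Psi i + q) (fun t => t ^ (j.shape k - q) * Real.exp (-t)) x) _ hz,
    powerAverage_rpow_mul 0 q _ hz, zero_add]
  · ring
  · intro x hx
    rw [← powerAverage_rpow_mul _ q _ hx]
    refine powerAverage_congr _ (fun t ht => ?_) hx
    rw [← mul_assoc, ← Real.rpow_add ht, add_sub_cancel]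

/-- The bound on `q` keeps every remaining exponent `j.shape k - q` nonnegative. Only a term with
exponent exactly `0` contributes to the limit. -/
theorem isTame_cdfProfile (p : ℕ) {q : ℝ} (hq : 0 < q) (hb : q ≤ j.shape 0) :
    IsTame (j.cdfProfile p q) (∑ i, ∑ k ∈ Finset.range (p + 1), j.K1 p i k *
      ((if j.shape k - q = 0 then 1 else 0) / (j.Psi i + q) / q)) :=
  IsTame.sum _ fun i _ => IsTame.sum _ fun k _ => IsTame.const_mul
    (IsTame.powerAverage hq (IsTame.powerAverage (add_pos (j.Psi_pos i) hq)
      (isTame_rpow_mul_exp_neg (sub_nonneg.2 (hb.trans (j.shape_zero_le k)))))) _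

/-- In this form the coefficient is recognizable as the limit at `0+` of the corresponding twofold
average. -/
theorem asympCoeff_eq (i : Fin 3) (k : ℕ) :
    j.asympCoeff i k = 1 / (j.Psi i + j.shape k) / j.shape k := by
  have h1 := j.shape_pos k
  have h2 := add_pos (j.Psi_pos i) h1
  have h3 := Real.Gamma_pos_of_pos h1
  have h4 := Real.Gamma_pos_of_pos h2
  rw [asympCoeff, zero_add, add_comm 1 (j.shape k), add_assoc, add_comm 1 (_ + _),
    Real.Gamma_add_one h1.ne', Real.Gamma_add_one h2.ne']
  field_simp

end RFLink

namespace OpticalLink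

variable (d : OpticalLink)

/-- The CDF of the link divided by the power `q` of its argument. -/
noncomputable def cdfProfile (q z : ℝ) : ℝ :=
  powerAverage q (fun t => t ^ (d.rho / d.r - q) * d.decay t) z

theorem cdf_eq_profile {τ x : ℝ} (q : ℝ) (hτ : 0 < τ) (hx : 0 < x) :
    d.cdf τ x = d.Upsilon3 τ * d.Upsilon4 τ ^ (-(d.rho / d.r)) * ((d.Upsilon4 τ * x) ^ q *
      d.cdfProfile q (d.Upsilon4 τ * x)) := by
  have h4 := d.Upsilon4_pos hτ
  have hz := mul_pos h4 hx
  rw [d.cdf_eq hτ hx, cdfProfile]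
  have h := powerAverage_rpow_mul q (d.rho / d.r - q) d.decay hz
  rw [add_sub_cancel] at h
  rw [h, ← mul_assoc _ _ (powerAverage _ _ _), ← Real.rpow_add hz, add_sub_cancel,
    Real.mul_rpow h4.le hx.le, Real.rpow_neg h4.le]
  have := (Real.rpow_pos_of_pos h4 (d.rho / d.r)).ne'
  field_simp

theorem isTame_cdfProfile {q : ℝ} (hq : 0 < q) (hb : q ≤ d.rho / d.r) :
    ∃ l, IsTame (d.cdfProfile q) l := by
  obtain ⟨l, hl⟩ := d.isTame_rpow_mul_decay (sub_nonneg.2 hb)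
  exact ⟨_, hl.powerAverage hq⟩

theorem Upsilon4_eq_mul_inv (τ : ℝ) : d.Upsilon4 τ = d.Upsilon4 1 * τ⁻¹ := by
  rw [Upsilon4, Upsilon4, mul_one, ← div_div, div_eq_mul_inv _ τ]

/-- Both `Υ₃` and `Υ₄ ^ (ρ / r)` are proportional to `τ ^ (-ρ / r)`. Hence the optical CDF depends
on `τ` only through `Υ₄ x`. -/
theorem Upsilon3_mul_Upsilon4_rpow {τ : ℝ} (hτ : 0 < τ) :
    d.Upsilon3 τ * d.Upsilon4 τ ^ (-(d.rho / d.r)) =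
      d.Upsilon3 1 * d.Upsilon4 1 ^ (-(d.rho / d.r)) := by
  have h1 := d.meanY_pos
  have h2 := d.w_pos
  have h3 := d.r_pos
  have h5 : d.Upsilon3 τ = d.Upsilon3 1 * (τ ^ (d.rho / d.r))⁻¹ := by
    have := Real.Gamma_pos_of_pos d.rho_pos
    unfold Upsilon3
    rw [Real.one_rpow]
    field_simp
  have h6 := (Real.rpow_pos_of_pos hτ (d.rho / d.r)).ne'
  rw [d.Upsilon4_eq_mul_inv τ, h5, Real.mul_rpow (d.Upsilon4_pos one_pos).le (inv_nonneg.2 hτ.le),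
    Real.inv_rpow hτ.le, Real.rpow_neg hτ.le, inv_inv]
  field_simp

theorem lower_nonneg (k : Fin d.r) : 0 ≤ d.lower k := by
  unfold lower Upsilon5
  rcases d.r_eq with h | h <;> split_ifs <;> norm_num [h]

theorem lower_eq_zero_iff (k : Fin d.r) : d.lower k = 0 ↔ (k : ℕ) = 0 := by
  unfold lower Upsilon5
  have hk := k.2
  rcases d.r_eq with h | h
  · have : (k : ℕ) = 0 := by omega
    simp [this]
  · split_ifs with h0 <;> simp [h0, h]
    norm_num

/-- The leading optical coefficient equals the limit of the profile at `0+`. For `r = 2` the product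
is the single factor `Γ(1/2) = √π`. -/
theorem asympCoeff_of_val_eq_zero (k : Fin d.r) (hk : (k : ℕ) = 0) :
    d.asympCoeff k = (if d.r = 1 then 1 else Real.sqrt Real.pi) / (d.rho / d.r) := by
  have ha := d.rho_div_r_pos
  have hT : d.T k = 1 := by simp [T, lower, hk]
  have hp : ∏ l ∈ Finset.univ.erase k, Real.Gamma (d.T k - d.T l) =
      if d.r = 1 then 1 else Real.sqrt Real.pi := by
    rcases d with ⟨N, mY, vY, r, hN, hm, hv, h⟩
    rcases h with rfl | rfl
    · have e : Finset.univ.erase k = ∅ := by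
        ext l
        simp [Subsingleton.elim l k]
      rw [e, Finset.prod_empty]
      simp
    · have e : Finset.univ.erase k = {(1 : Fin 2)} := by
        obtain rfl : k = (0 : Fin 2) := Fin.ext hk
        rfl
      rw [e, Finset.prod_singleton, hT]
      simp only [T, lower, Upsilon5]
      norm_num [Real.Gamma_one_half_eq]
  have hg := Real.Gamma_pos_of_pos ha
  rw [asympCoeff, hp, hT, Tlast, add_sub_cancel_left, add_sub_cancel_left, add_comm 1,
    Real.Gamma_add_one ha.ne']
  field_simp

end OpticalLink

/-! ### Integrals against rescaled tame functions -/

theorem IsTame.integrableOn_comp_mul {f : ℝ → ℝ} {l : ℝ} (hf : IsTame f l) {g : ℝ → ℝ}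
    (hg : IntegrableOn g (Ioi 0)) {c : ℝ} (hc : 0 < c) :
    IntegrableOn (fun x => f (c * x) * g x) (Ioi 0) := by
  obtain ⟨M, hM⟩ := hf.bounded
  refine Integrable.bdd_mul (c := M) hg
    (hf.measurable.comp (measurable_const_mul c)).aestronglyMeasurable ?_
  filter_upwards [ae_restrict_mem measurableSet_Ioi] with x hx
  exact hM _ (mul_pos hc hx)

theorem IsTame.tendsto_integral_comp_mul {f : ℝ → ℝ} {l : ℝ} (hf : IsTame f l) {g : ℝ → ℝ}
    (hg : IntegrableOn g (Ioi 0)) :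
    Tendsto (fun c => ∫ x in Ioi (0 : ℝ), f (c * x) * g x) (𝓝[>] 0)
      (𝓝 (l * ∫ x in Ioi (0 : ℝ), g x)) := by
  obtain ⟨M, hM⟩ := hf.bounded
  rw [← integral_const_mul]
  refine tendsto_integral_filter_of_dominated_convergence (fun x => M * ‖g x‖) ?_ ?_
    (hg.norm.const_mul M) ?_
  · filter_upwards [self_mem_nhdsWithin] with c hc
    exact (hf.integrableOn_comp_mul hg hc).aestronglyMeasurable
  · filter_upwards [self_mem_nhdsWithin] with c hc
    filter_upwards [ae_restrict_mem measurableSet_Ioi] with x hx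
    rw [norm_mul]
    exact mul_le_mul_of_nonneg_right (hM _ (mul_pos hc hx)) (norm_nonneg _)
  · filter_upwards [ae_restrict_mem measurableSet_Ioi] with x hx
    refine (hf.tendsto.comp (tendsto_nhdsWithin_iff.2
      ⟨?_, eventually_nhdsWithin_of_forall fun c (hc : 0 < c) => mul_pos hc hx⟩)).mul_const _
    have : Tendsto (fun c : ℝ => c * x) (𝓝 0) (𝓝 (0 * x)) := (continuous_mul_const x).tendsto 0
    rw [zero_mul] at this
    exact this.mono_left nhdsWithin_le_nhds

/-- Uniformity in both scales is what the product of the two CDFs requires, as the two SNRs are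
unrelated. -/
theorem exists_abs_integral_comp_mul_le {f₁ f₂ g : ℝ → ℝ} {l₁ l₂ : ℝ} (h₁ : IsTame f₁ l₁)
    (h₂ : IsTame f₂ l₂) (hg : IntegrableOn g (Ioi 0)) :
    ∃ C, ∀ c₁ c₂ : ℝ, 0 < c₁ → 0 < c₂ →
      |∫ x in Ioi (0 : ℝ), f₁ (c₁ * x) * (f₂ (c₂ * x) * g x)| ≤ C := by
  obtain ⟨M₁, hM₁⟩ := h₁.bounded
  obtain ⟨M₂, hM₂⟩ := h₂.bounded
  refine ⟨∫ x in Ioi (0 : ℝ), M₁ * (M₂ * |g x|), fun c₁ c₂ hc₁ hc₂ => ?_⟩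
  rw [← Real.norm_eq_abs]
  refine norm_integral_le_of_norm_le ((hg.abs.const_mul M₂).const_mul M₁) ?_
  filter_upwards [ae_restrict_mem measurableSet_Ioi] with x hx
  rw [norm_mul, norm_mul]
  have h1 := hM₁ _ (mul_pos hc₁ hx)
  have h2 := hM₂ _ (mul_pos hc₂ hx)
  exact mul_le_mul h1 (mul_le_mul_of_nonneg_right h2 (abs_nonneg _)) (by positivity)
    ((abs_nonneg _).trans h1)

/-- The difference is `k o(1) + u o(1)`, while the right-hand side is eventually at least `D (k +
u)` because both limits are positive. No comparison between `k` and `u` is needed. -/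
theorem isEquivalent_of_common_scales {ι : Type*} {l : Filter ι} {k u a b c a' b' : ι → ℝ}
    {A B : ℝ} (hA : 0 < A) (hB : 0 < B) (hk : ∀ᶠ s in l, 0 < k s) (hu : ∀ᶠ s in l, 0 < u s)
    (ha : Tendsto a l (𝓝 A)) (hb : Tendsto b l (𝓝 B)) (hc : Tendsto c l (𝓝 0))
    (ha' : Tendsto a' l (𝓝 A)) (hb' : Tendsto b' l (𝓝 B)) :
    Asymptotics.IsEquivalent l (fun s => k s * a s + u s * b s - k s * c s)
      (fun s => k s * a' s + u s * b' s) := by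
  set D := min (A / 2) (B / 2)
  have hD : 0 < D := lt_min (half_pos hA) (half_pos hB)
  refine Asymptotics.isLittleO_iff.2 fun ε hε => ?_
  have h1 : Tendsto (fun s => a s - c s - a' s) l (𝓝 0) := by simpa using (ha.sub hc).sub ha'
  have h2 : Tendsto (fun s => b s - b' s) l (𝓝 0) := by simpa using hb.sub hb'
  have hεD : 0 < ε * D := mul_pos hε hD
  have ha2 : D < A := (min_le_left _ _).trans_lt (half_lt_self hA)
  have hb2 : D < B := (min_le_right _ _).trans_lt (half_lt_self hB)
  filter_upwards [hk, hu, h1.abs.eventually (gt_mem_nhds (by simpa using hεD)),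
    h2.abs.eventually (gt_mem_nhds (by simpa using hεD)), ha'.eventually (lt_mem_nhds ha2),
    hb'.eventually (lt_mem_nhds hb2)] with s hks hus hs1 hs2 hs3 hs4
  simp only [Pi.sub_apply, Real.norm_eq_abs]
  have e : k s * a s + u s * b s - k s * c s - (k s * a' s + u s * b' s) =
      k s * (a s - c s - a' s) + u s * (b s - b' s) := by ring
  rw [e]
  calc |k s * (a s - c s - a' s) + u s * (b s - b' s)|
      ≤ k s * |a s - c s - a' s| + u s * |b s - b' s| := by
        refine (abs_add_le _ _).trans_eq ?_
        rw [abs_mul, abs_mul, abs_of_pos hks, abs_of_pos hus]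
    _ ≤ k s * (ε * D) + u s * (ε * D) := by gcongr
    _ = ε * (k s * D + u s * D) := by ring
    _ ≤ ε * (k s * a' s + u s * b' s) := by gcongr
    _ ≤ ε * |k s * a' s + u s * b' s| := by gcongr; exact le_abs_self _

/-! ### The closed form and the integral of the asymptotic CDF -/

/-- The quotients of Gamma values in the optical part of the closed form, summed against the
coefficients of the density of the link `E`. -/
noncomputable def opticalMoment (E : RFLink) (d : OpticalLink) (p : ℕ) (γE : ℝ) (k₂ : Fin d.r) : ℝ :=
  ∑ i, ∑ k ∈ Finset.range (p + 1), E.K1 p i k *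
    ((Real.Gamma (E.shape k + d.rho / d.r - d.T k₂ + 1) *
        Real.Gamma (E.Psi i - d.rho / d.r + d.T k₂ - 1)) /
      (E.K2 γE ^ (d.rho / d.r - d.T k₂ + 1) * Real.Gamma (E.Psi i - d.rho / d.r + d.T k₂)))

theorem opticalMoment_eq (E : RFLink) (d : OpticalLink) (p : ℕ) (γE : ℝ) (k₂ : Fin d.r)
    (h : d.rho / d.r + d.lower k₂ < E.Psi 0) :
    opticalMoment E d p γE k₂ = E.moment p γE (d.rho / d.r + d.lower k₂) := by
  refine Finset.sum_congr rfl fun i _ => Finset.sum_congr rfl fun k _ => ?_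
  have h1 : 0 < E.Psi i - (d.rho / d.r + d.lower k₂) := by linarith [E.Psi_zero_le i]
  have h2 := Real.Gamma_pos_of_pos h1
  rw [OpticalLink.T,
    show E.shape k + d.rho / d.r - (1 - d.lower k₂) + 1 = d.rho / d.r + d.lower k₂ + E.shape k by
      ring,
    show d.rho / d.r - (1 - d.lower k₂) + 1 = d.rho / d.r + d.lower k₂ by ring,
    show E.Psi i - d.rho / d.r + (1 - d.lower k₂) - 1 = E.Psi i - (d.rho / d.r + d.lower k₂) by
      ring,
    show E.Psi i - d.rho / d.r + (1 - d.lower k₂) =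
      E.Psi i - (d.rho / d.r + d.lower k₂) + 1 by ring, Real.Gamma_add_one h1.ne']
  field_simp

theorem sum_sum_sum_sum_comm {ι κ : Type*} (s : Finset ι) (t : Finset κ)
    (F : ι → κ → ι → κ → ℝ) :
    ∑ i ∈ s, ∑ k ∈ t, ∑ i' ∈ s, ∑ k' ∈ t, F i k i' k' =
      ∑ i' ∈ s, ∑ k' ∈ t, ∑ i ∈ s, ∑ k ∈ t, F i k i' k' := by
  simp only [← Finset.sum_product' (s := s) (t := t)]
  exact Finset.sum_comm

/-- The closed form as a sum over the terms of the asymptotic CDF. -/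
theorem sopClosedForm_eq (R E : RFLink) (d : OpticalLink) (p : ℕ) {φ γE γR τ : ℝ} (hφ : 0 < φ)
    (hγR : 0 < γR) (hτ : 0 < τ) :
    sopClosedForm R E d p φ γE γR τ =
      (∑ i, ∑ k ∈ Finset.range (p + 1), R.K1 p i k * (R.K2 γR * φ) ^ R.shape k *
        R.asympCoeff i k * E.moment p γE (R.shape k)) +
      ∑ k₂, d.Upsilon3 τ * φ ^ (d.rho / d.r + d.lower k₂) * d.Upsilon4 τ ^ d.lower k₂ *
        d.asympCoeff k₂ * opticalMoment E d p γE k₂ := by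
  simp only [sopClosedForm, mul_add, Finset.sum_add_distrib]
  congr 1
  · simp only [RFLink.moment, Finset.mul_sum]
    rw [sum_sum_sum_sum_comm]
    refine Finset.sum_congr rfl fun iR _ => Finset.sum_congr rfl fun kR _ =>
      Finset.sum_congr rfl fun i _ => Finset.sum_congr rfl fun k _ => ?_
    rw [Real.rpow_neg (mul_pos (R.K2_pos hγR) hφ).le, div_inv_eq_mul]
    ring
  · simp only [opticalMoment, Finset.mul_sum]
    conv_rhs => rw [Finset.sum_comm]
    refine Finset.sum_congr rfl fun i _ => ?_
    conv_rhs => rw [Finset.sum_comm]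
    refine Finset.sum_congr rfl fun k _ => Finset.sum_congr rfl fun k₂ _ => ?_
    rw [show d.rho / d.r - d.T k₂ + 1 = d.rho / d.r + d.lower k₂ by rw [OpticalLink.T]; ring,
      show d.lower k₂ = -(d.T k₂ - 1) by rw [OpticalLink.T]; ring,
      Real.rpow_neg (d.Upsilon4_pos hτ).le]
    ring

/-- The asymptotic CDF is a sum of powers. -/
theorem cdfEqAsymp_eq (R : RFLink) (d : OpticalLink) (p : ℕ) {φ γR τ x : ℝ} (hφ : 0 < φ)
    (hγR : 0 < γR) (hτ : 0 < τ) (hx : 0 < x) :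
    cdfEqAsymp R d p γR τ (φ * x) =
      (∑ i, ∑ k ∈ Finset.range (p + 1), R.K1 p i k * (R.K2 γR * φ) ^ R.shape k *
        R.asympCoeff i k * x ^ R.shape k) +
      ∑ k₂, d.Upsilon3 τ * φ ^ (d.rho / d.r + d.lower k₂) * d.Upsilon4 τ ^ d.lower k₂ *
        d.asympCoeff k₂ * x ^ (d.rho / d.r + d.lower k₂) := by
  have hK := mul_pos (R.K2_pos hγR) hφ
  have hU := d.Upsilon4_pos hτ
  have hφx := mul_pos hφ hx
  rw [cdfEqAsymp, RFLink.cdfAsymp, OpticalLink.cdfAsymp, Finset.mul_sum]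
  congr 1
  · refine Finset.sum_congr rfl fun i _ => Finset.sum_congr rfl fun k _ => ?_
    rw [← mul_assoc, Real.rpow_neg (mul_pos hK hx).le, div_inv_eq_mul, Real.mul_rpow hK.le hx.le]
    ring
  · refine Finset.sum_congr rfl fun k₂ _ => ?_
    rw [OpticalLink.T, sub_sub_cancel_left, one_div, Real.inv_rpow (mul_pos hU hφx).le,
      Real.rpow_neg (mul_pos hU hφx).le, inv_inv, Real.mul_rpow hU.le hφx.le,
      Real.rpow_add hφ, Real.rpow_add hx, Real.mul_rpow hφ.le hx.le, Real.mul_rpow hφ.le hx.le]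
    ring

theorem integral_cdfEqAsymp_mul_pdf (R E : RFLink) (d : OpticalLink) (p : ℕ) {φ γE γR τ : ℝ}
    (hφ : 0 < φ) (hγE : 0 < γE) (hγR : 0 < γR) (hτ : 0 < τ)
    (hR : ∀ k ∈ Finset.range (p + 1), R.shape k < E.Psi 0)
    (hd : ∀ k₂, d.rho / d.r + d.lower k₂ < E.Psi 0) :
    IntegrableOn (fun x => cdfEqAsymp R d p γR τ (φ * x) * E.pdf p γE x) (Ioi 0) ∧
      ∫ x in Ioi (0 : ℝ), cdfEqAsymp R d p γR τ (φ * x) * E.pdf p γE x =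
        sopClosedForm R E d p φ γE γR τ := by
  have hmR := fun k hk => E.integral_rpow_mul_pdf p hγE (R.shape_pos k) (hR k hk)
  have hmd := fun k₂ => E.integral_rpow_mul_pdf p hγE
    (add_pos_of_pos_of_nonneg d.rho_div_r_pos (d.lower_nonneg k₂)) (hd k₂)
  set cR : Fin 3 → ℕ → ℝ := fun i k =>
    R.K1 p i k * (R.K2 γR * φ) ^ R.shape k * R.asympCoeff i k with hcR
  set cd : Fin d.r → ℝ := fun k₂ => d.Upsilon3 τ * φ ^ (d.rho / d.r + d.lower k₂) *
    d.Upsilon4 τ ^ d.lower k₂ * d.asympCoeff k₂ with hcd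
  have e : EqOn (fun x => (∑ i, ∑ k ∈ Finset.range (p + 1),
      cR i k * (x ^ R.shape k * E.pdf p γE x)) +
      ∑ k₂, cd k₂ * (x ^ (d.rho / d.r + d.lower k₂) * E.pdf p γE x))
      (fun x => cdfEqAsymp R d p γR τ (φ * x) * E.pdf p γE x) (Ioi 0) := fun x hx => by
    beta_reduce
    rw [cdfEqAsymp_eq R d p hφ hγR hτ hx, add_mul]
    simp only [Finset.sum_mul, mul_assoc, hcR, hcd]
  have hiR : ∀ i, ∀ k ∈ Finset.range (p + 1), IntegrableOn (fun x =>
      cR i k * (x ^ R.shape k * E.pdf p γE x)) (Ioi 0) := fun i k hk => (hmR k hk).1.const_mul _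
  have hiR' := fun i => integrable_finsetSum _ (hiR i)
  have hid := fun k₂ (_ : k₂ ∈ Finset.univ) => (hmd k₂).1.const_mul (cd k₂)
  have h1 := integrable_finsetSum Finset.univ fun i _ => hiR' i
  have h2 := integrable_finsetSum Finset.univ hid
  refine ⟨IntegrableOn.congr_fun (h1.add h2) e measurableSet_Ioi, ?_⟩
  rw [← setIntegral_congr_fun measurableSet_Ioi e, integral_add h1 h2,
    integral_finsetSum _ fun i _ => hiR' i, integral_finsetSum _ hid,
    sopClosedForm_eq R E d p hφ hγR hτ]
  congr 1
  · refine Finset.sum_congr rfl fun i _ => ?_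
    rw [integral_finsetSum _ (hiR i)]
    refine Finset.sum_congr rfl fun k hk => ?_
    rw [integral_const_mul, (hmR k hk).2]
  · refine Finset.sum_congr rfl fun k₂ _ => ?_
    rw [integral_const_mul, (hmd k₂).2, opticalMoment_eq E d p γE k₂ (hd k₂)]

/-! ### The scales at high SNR -/

namespace RFLink

theorem K2_eq_mul_inv (j : RFLink) (γ : ℝ) : j.K2 γ = j.K2 1 * γ⁻¹ := by
  rw [K2, K2, mul_one, ← div_div, div_eq_mul_inv _ γ]

theorem tendsto_K2 (j : RFLink) : Tendsto j.K2 atTop (𝓝[>] 0) := by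
  refine tendsto_nhdsWithin_iff.2 ⟨?_, ?_⟩
  · have h := tendsto_inv_atTop_zero.const_mul (j.K2 1)
    rw [mul_zero] at h
    exact h.congr fun γ => (j.K2_eq_mul_inv γ).symm
  · filter_upwards [eventually_gt_atTop 0] with γ hγ using j.K2_pos hγ

end RFLink

namespace OpticalLink

theorem tendsto_Upsilon4 (d : OpticalLink) : Tendsto d.Upsilon4 atTop (𝓝[>] 0) := by
  refine tendsto_nhdsWithin_iff.2 ⟨?_, ?_⟩
  · have h := tendsto_inv_atTop_zero.const_mul (d.Upsilon4 1)
    rw [mul_zero] at h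
    exact h.congr fun τ => (d.Upsilon4_eq_mul_inv τ).symm
  · filter_upwards [eventually_gt_atTop 0] with τ hτ using d.Upsilon4_pos hτ

theorem isTame_cdfProfile_self (d : OpticalLink) : IsTame (d.cdfProfile (d.rho / d.r))
    ((if d.r = 1 then 1 else Real.sqrt Real.pi) / (d.rho / d.r)) := by
  have h := d.isTame_decay.powerAverage d.rho_div_r_pos
  refine (congrArg (IsTame · _) ?_).mp h
  unfold cdfProfile
  simp

end OpticalLink

/-! ### Integrals of the exact CDFs -/

section Integrals

variable (R E : RFLink) (d : OpticalLink) (p : ℕ) {φ γE γR τ : ℝ}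

/-- The power `q` is free: any small one gives convergence, and `q = R.shape 0` displays the exact
rate of decay. -/
theorem integral_cdf_mul_pdf {q : ℝ} (hφ : 0 < φ) (hγE : 0 < γE) (hγR : 0 < γR) (hq : 0 < q)
    (hqR : q ≤ R.shape 0) (hqE : q < E.Psi 0) :
    IntegrableOn (fun x => R.cdf p γR (φ * x) * E.pdf p γE x) (Ioi 0) ∧
      ∫ x in Ioi (0 : ℝ), R.cdf p γR (φ * x) * E.pdf p γE x = (R.K2 γR * φ) ^ q *
        ∫ x in Ioi (0 : ℝ), R.cdfProfile p q (R.K2 γR * φ * x) * (x ^ q * E.pdf p γE x) := by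
  have hK := mul_pos (R.K2_pos hγR) hφ
  have hi := (R.isTame_cdfProfile p hq hqR).integrableOn_comp_mul
    (E.integral_rpow_mul_pdf p hγE hq hqE).1 hK
  have e : EqOn (fun x => (R.K2 γR * φ) ^ q *
      (R.cdfProfile p q (R.K2 γR * φ * x) * (x ^ q * E.pdf p γE x)))
      (fun x => R.cdf p γR (φ * x) * E.pdf p γE x) (Ioi 0) := fun x (hx : 0 < x) => by
    beta_reduce
    rw [R.cdf_eq p q hγR (mul_pos hφ hx), ← mul_assoc (R.K2 γR), Real.mul_rpow hK.le hx.le]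
    ring
  refine ⟨IntegrableOn.congr_fun (hi.const_mul _) e measurableSet_Ioi, ?_⟩
  rw [← setIntegral_congr_fun measurableSet_Ioi e, integral_const_mul]

theorem integral_optical_cdf_mul_pdf {q : ℝ} (hφ : 0 < φ) (hγE : 0 < γE) (hτ : 0 < τ)
    (hq : 0 < q) (hqd : q ≤ d.rho / d.r) (hqE : q < E.Psi 0) :
    IntegrableOn (fun x => d.cdf τ (φ * x) * E.pdf p γE x) (Ioi 0) ∧
      ∫ x in Ioi (0 : ℝ), d.cdf τ (φ * x) * E.pdf p γE x =
        d.Upsilon3 τ * d.Upsilon4 τ ^ (-(d.rho / d.r)) * (d.Upsilon4 τ * φ) ^ q *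
          ∫ x in Ioi (0 : ℝ), d.cdfProfile q (d.Upsilon4 τ * φ * x) * (x ^ q * E.pdf p γE x) := by
  have hU := mul_pos (d.Upsilon4_pos hτ) hφ
  obtain ⟨l, hl⟩ := d.isTame_cdfProfile hq hqd
  have hi := hl.integrableOn_comp_mul (E.integral_rpow_mul_pdf p hγE hq hqE).1 hU
  have e : EqOn (fun x => d.Upsilon3 τ * d.Upsilon4 τ ^ (-(d.rho / d.r)) * (d.Upsilon4 τ * φ) ^ q *
      (d.cdfProfile q (d.Upsilon4 τ * φ * x) * (x ^ q * E.pdf p γE x)))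
      (fun x => d.cdf τ (φ * x) * E.pdf p γE x) (Ioi 0) := fun x (hx : 0 < x) => by
    beta_reduce
    rw [d.cdf_eq_profile q hτ (mul_pos hφ hx), ← mul_assoc (d.Upsilon4 τ),
      Real.mul_rpow hU.le hx.le]
    ring
  refine ⟨IntegrableOn.congr_fun (hi.const_mul _) e measurableSet_Ioi, ?_⟩
  rw [← setIntegral_congr_fun measurableSet_Ioi e, integral_const_mul]

/-- Separate powers are taken from the two CDFs, since only their sum is limited by the moments of
the eavesdropper's SNR; the optical one may stay below its leading exponent. -/
theorem integral_cdf_mul_cdf_mul_pdf {q q' : ℝ} (hφ : 0 < φ) (hγE : 0 < γE) (hγR : 0 < γR)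
    (hτ : 0 < τ) (hq : 0 < q) (hqR : q ≤ R.shape 0) (hq' : 0 < q') (hqd : q' ≤ d.rho / d.r)
    (hqE : q + q' < E.Psi 0) :
    IntegrableOn (fun x => R.cdf p γR (φ * x) * d.cdf τ (φ * x) * E.pdf p γE x) (Ioi 0) ∧
      ∫ x in Ioi (0 : ℝ), R.cdf p γR (φ * x) * d.cdf τ (φ * x) * E.pdf p γE x =
        (R.K2 γR * φ) ^ q * (d.Upsilon3 τ * d.Upsilon4 τ ^ (-(d.rho / d.r)) *
          (d.Upsilon4 τ * φ) ^ q' * ∫ x in Ioi (0 : ℝ), R.cdfProfile p q (R.K2 γR * φ * x) *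
            (d.cdfProfile q' (d.Upsilon4 τ * φ * x) * (x ^ (q + q') * E.pdf p γE x))) := by
  have hK := mul_pos (R.K2_pos hγR) hφ
  have hU := mul_pos (d.Upsilon4_pos hτ) hφ
  obtain ⟨l, hl⟩ := d.isTame_cdfProfile hq' hqd
  have hi := (R.isTame_cdfProfile p hq hqR).integrableOn_comp_mul (hl.integrableOn_comp_mul
    (E.integral_rpow_mul_pdf p hγE (add_pos hq hq') hqE).1 hU) hK
  have e : EqOn (fun x => (R.K2 γR * φ) ^ q * (d.Upsilon3 τ * d.Upsilon4 τ ^ (-(d.rho / d.r)) *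
      (d.Upsilon4 τ * φ) ^ q' * (R.cdfProfile p q (R.K2 γR * φ * x) *
        (d.cdfProfile q' (d.Upsilon4 τ * φ * x) * (x ^ (q + q') * E.pdf p γE x)))))
      (fun x => R.cdf p γR (φ * x) * d.cdf τ (φ * x) * E.pdf p γE x) (Ioi 0) :=
      fun x (hx : 0 < x) => by
    beta_reduce
    rw [R.cdf_eq p q hγR (mul_pos hφ hx), ← mul_assoc (R.K2 γR), Real.mul_rpow hK.le hx.le,
      d.cdf_eq_profile q' hτ (mul_pos hφ hx), ← mul_assoc (d.Upsilon4 τ),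
      Real.mul_rpow hU.le hx.le, Real.rpow_add hx]
    ring
  refine ⟨IntegrableOn.congr_fun ((hi.const_mul _).const_mul _) e measurableSet_Ioi, ?_⟩
  rw [← setIntegral_congr_fun measurableSet_Ioi e, integral_const_mul, integral_const_mul]

theorem integral_cdfEq_mul_pdf (hφ : 0 < φ) (hγE : 0 < γE) (hγR : 0 < γR) (hτ : 0 < τ) :
    IntegrableOn (fun x => cdfEq R d p γR τ (φ * x) * E.pdf p γE x) (Ioi 0) ∧
      sopLower R E d p φ γE γR τ =
        (∫ x in Ioi (0 : ℝ), R.cdf p γR (φ * x) * E.pdf p γE x) +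
        (∫ x in Ioi (0 : ℝ), d.cdf τ (φ * x) * E.pdf p γE x) -
        ∫ x in Ioi (0 : ℝ), R.cdf p γR (φ * x) * d.cdf τ (φ * x) * E.pdf p γE x := by
  -- One `q` serves all three integrals; the bound `Ψ₀ / 2` is there for the product, which uses the
  -- moment of order `2 q`.
  obtain ⟨q, hq, hq'⟩ := exists_between (lt_min (lt_min R.shape_zero_pos d.rho_div_r_pos)
    (half_pos (E.Psi_pos 0)))
  simp only [lt_min_iff] at hq'
  obtain ⟨⟨h1, h2⟩, h3⟩ := hq'
  have h4 := E.Psi_pos 0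
  have hR := (integral_cdf_mul_pdf R E p hφ hγE hγR hq h1.le (by linarith)).1
  have hd := (integral_optical_cdf_mul_pdf E d p hφ hγE hτ hq h2.le (by linarith)).1
  have hRd := (integral_cdf_mul_cdf_mul_pdf R E d p hφ hγE hγR hτ hq h1.le hq h2.le
    (by linarith)).1
  have e : (fun x => cdfEq R d p γR τ (φ * x) * E.pdf p γE x) = fun x =>
      R.cdf p γR (φ * x) * E.pdf p γE x + d.cdf τ (φ * x) * E.pdf p γE x -
        R.cdf p γR (φ * x) * d.cdf τ (φ * x) * E.pdf p γE x := by
    ext x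
    rw [cdfEq]
    ring
  rw [sopLower, e]
  refine ⟨(hR.add hd).sub hRd, ?_⟩
  exact (integral_sub (hR.add hd) hRd).trans (congrArg (· - _) (integral_add hR hd))

end Integrals

/-! ### The high SNR equivalence -/

theorem isEquivalent_sopLower (R E : RFLink) (d : OpticalLink) {p : ℕ} (hp : 1 ≤ p) {φ γE : ℝ}
    (hφ : 0 < φ) (hγE : 0 < γE) (hR : R.shape 0 < E.Psi 0) (hd : d.rho / d.r < E.Psi 0) :
    Asymptotics.IsEquivalent (atTop ×ˢ atTop)
      (fun s : ℝ × ℝ => sopLower R E d p φ γE s.1 s.2)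
      (fun s : ℝ × ℝ => sopClosedForm R E d p φ γE s.1 s.2) := by
  set a := d.rho / d.r with ha
  set b := R.shape 0 with hb
  have ha0 : 0 < a := d.rho_div_r_pos
  have hb0 : 0 < b := R.shape_zero_pos
  set g := ∑ i, ∑ k ∈ Finset.range (p + 1), R.K1 p i k *
      ((if R.shape k - b = 0 then 1 else 0) / (R.Psi i + b) / b) with hg
  set g' := (if d.r = 1 then 1 else Real.sqrt Real.pi) / a with hg'
  -- The exponents are `b + k`, so the indicator in the limit of the profile singles out `k = 0`.
  have hterm : ∀ k, (if R.shape k - b = 0 then (1 : ℝ) else 0) = 0 ^ k := fun k => by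
    simp only [R.shape_eq k, hb, add_sub_cancel_left, Nat.cast_eq_zero, zero_pow_eq]
  have hg0 : 0 < g := by
    have e : g = R.fadingCoeff p 0 / b * ∑ i, rwpC i / (R.Psi i + b) := by
      rw [hg, Finset.mul_sum]
      refine Finset.sum_congr rfl fun i _ => ?_
      rw [Finset.sum_eq_single 0 (fun k _ hk => by rw [hterm, zero_pow hk]; simp) (by simp),
        hterm, pow_zero, R.K1_eq]
      ring
    rw [e]
    exact mul_pos (div_pos (R.fadingCoeff_pos hp (by simp)) hb0)
      (R.sum_rwpC_div_pos (by linarith [R.Psi_pos 0]))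
  have hg'0 : 0 < g' := by
    have := Real.pi_pos
    refine div_pos ?_ ha0
    split_ifs <;> positivity
  have hmb := E.integral_rpow_mul_pdf p hγE hb0 hR
  have hma := E.integral_rpow_mul_pdf p hγE ha0 hd
  have hmb0 := E.moment_pos hp hγE hb0 hR
  have hma0 := E.moment_pos hp hγE ha0 hd
  -- The product of the CDFs gets the full relay rate `b` and an extra optical power `q`: `q < a`
  -- keeps the profile bounded, `b + q < Ψ₀` keeps the moment finite.
  obtain ⟨q, hq0, hq⟩ := exists_between (lt_min ha0 (sub_pos.2 hR))
  rw [lt_min_iff, lt_sub_iff_add_lt'] at hq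
  have hmq := E.integral_rpow_mul_pdf p hγE (add_pos hb0 hq0) hq.2
  obtain ⟨l, hl⟩ := d.isTame_cdfProfile hq0 hq.1.le
  have htR := R.isTame_cdfProfile p hb0 le_rfl
  obtain ⟨C, hC⟩ := exists_abs_integral_comp_mul_le htR hl hmq.1
  have hK : Tendsto (fun s : ℝ × ℝ => R.K2 s.1) (atTop ×ˢ atTop) (𝓝[>] 0) :=
    R.tendsto_K2.comp tendsto_fst
  have hU : Tendsto (fun s : ℝ × ℝ => d.Upsilon4 s.2) (atTop ×ˢ atTop) (𝓝[>] 0) :=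
    d.tendsto_Upsilon4.comp tendsto_snd
  have hscale : Tendsto (fun c : ℝ => c * φ) (𝓝[>] 0) (𝓝[>] 0) := by
    refine tendsto_nhdsWithin_iff.2
      ⟨?_, eventually_nhdsWithin_of_forall fun c (hc : 0 < c) => mul_pos hc hφ⟩
    have h := (continuous_mul_const φ).tendsto 0
    rw [zero_mul] at h
    exact h.mono_left nhdsWithin_le_nhds
  have hpos : ∀ᶠ s : ℝ × ℝ in atTop ×ˢ atTop, 0 < s.1 ∧ 0 < s.2 :=
    (eventually_gt_atTop 0).prod_mk (eventually_gt_atTop 0)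
  -- The scales are `K₂ ^ b` and `Υ₃`. The product term `c` is charged entirely to the first, and
  -- the remaining `Υ₄ ^ q` makes it vanish.
  have key := isEquivalent_of_common_scales (l := (atTop ×ˢ atTop : Filter (ℝ × ℝ)))
    (k := fun s => R.K2 s.1 ^ b) (u := fun s => d.Upsilon3 s.2)
    (a := fun s => φ ^ b * ∫ x in Ioi (0 : ℝ),
      R.cdfProfile p b (R.K2 s.1 * φ * x) * (x ^ b * E.pdf p γE x))
    (b := fun s => φ ^ a * ∫ x in Ioi (0 : ℝ),
      d.cdfProfile a (d.Upsilon4 s.2 * φ * x) * (x ^ a * E.pdf p γE x))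
    (c := fun s => φ ^ b * (d.Upsilon3 s.2 * d.Upsilon4 s.2 ^ (-a) * (d.Upsilon4 s.2 * φ) ^ q *
      ∫ x in Ioi (0 : ℝ), R.cdfProfile p b (R.K2 s.1 * φ * x) *
        (d.cdfProfile q (d.Upsilon4 s.2 * φ * x) * (x ^ (b + q) * E.pdf p γE x))))
    (a' := fun s => ∑ i, ∑ k ∈ Finset.range (p + 1), R.K1 p i k * (R.K2 s.1 ^ k *
      φ ^ R.shape k) * R.asympCoeff i k * E.moment p γE (R.shape k))
    (b' := fun s => ∑ k₂, φ ^ (a + d.lower k₂) * d.Upsilon4 s.2 ^ d.lower k₂ *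
        d.asympCoeff k₂ * opticalMoment E d p γE k₂)
    (A := φ ^ b * (g * E.moment p γE b)) (B := φ ^ a * (g' * E.moment p γE a))
    (by positivity) (by positivity)
    (hpos.mono fun s hs => Real.rpow_pos_of_pos (R.K2_pos hs.1) b)
    (hpos.mono fun s hs => d.Upsilon3_pos hs.2) ?_ ?_ ?_ ?_ ?_
  · refine (key.congr_left (hpos.mono fun s hs => ?_)).congr_right (hpos.mono fun s hs => ?_)
    · have hK2 := R.K2_pos hs.1
      have hU4 := d.Upsilon4_pos hs.2
      beta_reduce
      rw [(integral_cdfEq_mul_pdf R E d p hφ hγE hs.1 hs.2).2,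
        (integral_cdf_mul_pdf R E p hφ hγE hs.1 hb0 le_rfl hR).2,
        (integral_optical_cdf_mul_pdf E d p hφ hγE hs.2 ha0 le_rfl hd).2,
        (integral_cdf_mul_cdf_mul_pdf R E d p hφ hγE hs.1 hs.2 hb0 le_rfl hq0 hq.1.le hq.2).2,
        Real.mul_rpow hK2.le hφ.le, Real.mul_rpow hU4.le hφ.le (z := a), ← ha,
        Real.rpow_neg hU4.le]
      have h4 := (Real.rpow_pos_of_pos hU4 a).ne'
      field_simp
    · have hK2 := R.K2_pos hs.1
      beta_reduce
      rw [sopClosedForm_eq R E d p hφ hs.1 hs.2, Finset.mul_sum, Finset.mul_sum]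
      congr 1
      · refine Finset.sum_congr rfl fun i _ => ?_
        rw [Finset.mul_sum]
        refine Finset.sum_congr rfl fun k _ => ?_
        rw [Real.mul_rpow hK2.le hφ.le, R.shape_eq k, Real.rpow_add hK2, Real.rpow_natCast]
        ring
      · refine Finset.sum_congr rfl fun k₂ _ => ?_
        ring
  · rw [← hmb.2]
    exact ((htR.tendsto_integral_comp_mul hmb.1).comp (hscale.comp hK)).const_mul _
  · rw [← hma.2]
    exact ((d.isTame_cdfProfile_self.tendsto_integral_comp_mul hma.1).comp
      (hscale.comp hU)).const_mul _
  · have h0 : Tendsto (fun s : ℝ × ℝ => (d.Upsilon4 s.2 * φ) ^ q) (atTop ×ˢ atTop) (𝓝 0) := by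
      have h := (Real.continuousAt_rpow_const 0 q (Or.inr hq0.le)).tendsto
      rw [Real.zero_rpow hq0.ne'] at h
      exact h.comp ((hscale.comp hU).mono_right nhdsWithin_le_nhds)
    have h1 := h0.const_mul (φ ^ b * |d.Upsilon3 1 * d.Upsilon4 1 ^ (-a)| * C)
    rw [mul_zero] at h1
    refine squeeze_zero_norm' (hpos.mono fun s hs => ?_) h1
    have hc := hC _ _ (mul_pos (R.K2_pos hs.1) hφ) (mul_pos (d.Upsilon4_pos hs.2) hφ)
    have hU4 := mul_pos (d.Upsilon4_pos hs.2) hφ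
    rw [d.Upsilon3_mul_Upsilon4_rpow hs.2, Real.norm_eq_abs, abs_mul, abs_mul, abs_mul,
      abs_of_pos (Real.rpow_pos_of_pos hφ b), abs_of_pos (Real.rpow_pos_of_pos hU4 q)]
    calc _ ≤ φ ^ b * (|d.Upsilon3 1 * d.Upsilon4 1 ^ (-a)| * (d.Upsilon4 s.2 * φ) ^ q * C) := by
          gcongr
      _ = _ := by ring
  -- A polynomial in `K₂`, so only `k = 0` survives at `0`. For `k > 0` the value of `moment` is a
  -- mere constant, and the integral it stands for need not converge.
  · have hcont : Continuous fun K : ℝ => ∑ i, ∑ k ∈ Finset.range (p + 1), R.K1 p i k * (K ^ k *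
      φ ^ R.shape k) * R.asympCoeff i k * E.moment p γE (R.shape k) := by fun_prop
    have h := (hcont.tendsto 0).comp (hK.mono_right nhdsWithin_le_nhds)
    convert! h using 2
    rw [hg, Finset.sum_mul, Finset.mul_sum]
    refine Finset.sum_congr rfl fun i _ => ?_
    rw [Finset.sum_mul, Finset.mul_sum]
    refine Finset.sum_congr rfl fun k _ => ?_
    rw [hterm]
    rcases eq_or_ne k 0 with rfl | hk
    · rw [R.asympCoeff_eq, pow_zero]
      ring
    · simp [zero_pow hk]
  -- The exponents `d.lower k₂` are nonnegative and vanish only for the first index, which alone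
  -- contributes at `0`.
  · have hcont : Continuous fun U : ℝ => ∑ k₂, φ ^ (a + d.lower k₂) * U ^ d.lower k₂ *
        d.asympCoeff k₂ * opticalMoment E d p γE k₂ :=
      continuous_finsetSum _ fun k₂ _ => ((continuous_const.mul
        (Real.continuous_rpow_const (d.lower_nonneg k₂))).mul continuous_const).mul
          continuous_const
    have h := (hcont.tendsto 0).comp (hU.mono_right nhdsWithin_le_nhds)
    convert! h using 2
    have hr : 0 < d.r := by exact_mod_cast d.r_pos
    have hl0 : d.lower ⟨0, hr⟩ = 0 := (d.lower_eq_zero_iff _).2 rfl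
    rw [Finset.sum_eq_single (⟨0, hr⟩ : Fin d.r) (fun k₂ _ hk => ?_) (by simp), hl0,
      opticalMoment_eq E d p γE _ (by rw [hl0, add_zero]; exact hd), hl0,
      d.asympCoeff_of_val_eq_zero _ rfl, Real.rpow_zero, add_zero]
    · ring
    · rw [Real.zero_rpow fun h0 => hk (Fin.ext ((d.lower_eq_zero_iff k₂).1 h0))]
      ring

theorem mainTheorem8 (R E : RFLink) (d : OpticalLink) (p : ℕ) (hp : 1 ≤ p)
    (Rs φ γE : ℝ) (hRs : 0 < Rs) (hφ : φ = 2 ^ Rs) (hγE : 0 < γE) :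
    -- the integral that defines the asymptotic SOP, in its domain of convergence
    ((∀ i : Fin 3, ∀ k ∈ Finset.range (p + 1), R.shape k < E.Psi i) →
      (∀ i : Fin 3, ∀ k₂ : Fin d.r, d.rho / d.r - d.T k₂ + 1 < E.Psi i) →
      ∀ γR τ : ℝ, 0 < γR → 0 < τ →
        IntegrableOn (fun x => cdfEqAsymp R d p γR τ (φ * x) * E.pdf p γE x) (Ioi 0) ∧
        ∫ x in Ioi (0 : ℝ), cdfEqAsymp R d p γR τ (φ * x) * E.pdf p γE x =
          sopClosedForm R E d p φ γE γR τ) ∧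
    -- the lower bound of the SOP is a convergent integral
    (∀ γR τ : ℝ, 0 < γR → 0 < τ →
      IntegrableOn (fun x => cdfEq R d p γR τ (φ * x) * E.pdf p γE x) (Ioi 0)) ∧
    -- the high SNR limit of the lower bound of the SOP
    ((∀ i : Fin 3, R.shape 0 < E.Psi i) → (∀ i : Fin 3, d.rho / d.r < E.Psi i) →
      (∀ i : Fin 3, ∀ k ∈ Finset.range (p + 1), R.shape k ≠ E.Psi i) →
      (∀ i : Fin 3, ∀ k₂ : Fin d.r, d.rho / d.r - d.T k₂ + 1 ≠ E.Psi i) →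
      Asymptotics.IsEquivalent (atTop ×ˢ atTop)
        (fun s : ℝ × ℝ => sopLower R E d p φ γE s.1 s.2)
        (fun s : ℝ × ℝ => sopClosedForm R E d p φ γE s.1 s.2)) := by
  have hφ0 : 0 < φ := hφ ▸ Real.rpow_pos_of_pos two_pos Rs
  refine ⟨fun hR hd γR τ hγR hτ => ?_, fun γR τ hγR hτ =>
    (integral_cdfEq_mul_pdf R E d p hφ0 hγE hγR hτ).1, fun hR hd _ _ =>
    isEquivalent_sopLower R E d hp hφ0 hγE (hR 0) (hd 0)⟩
  refine integral_cdfEqAsymp_mul_pdf R E d p hφ0 hγE hγR hτ (hR 0) fun k₂ => ?_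
  have h := hd 0 k₂
  rw [OpticalLink.T] at h
  linarith
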